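/- Let $d,\tilde\zeta>0$ and let $\tilde f\in\mathbb R$ satisfy $0<|\tilde f|<\frac{2\sqrt3}{9}\tilde\zeta^{3/2}$. Then there exist $\varepsilon_0,\kappa_0>0$ (depending only on $d,\tilde\zeta,\tilde f$) such that for all $\varepsilon\in(0,\varepsilon_0)$ and $\kappa\in(0,\kappa_0)$ there are two distinct even homoclinic solutions $a^{(1)}_{\varepsilon,\kappa},a^{(2)}_{\varepsilon,\kappa}:\mathbb R\to\mathbb C$ of the stationary Lugiato–Lefever equation with nonlinear damping $$-d\,a''-(\mathrm i-\zeta)a-(1+\mathrm i\kappa)|a|^2a+\mathrm i f=0\ \text{ on }\mathbb R,\qquad a'(0)=0,$$ with $\zeta=\tilde\zeta\varepsilon^{-1}$ and $f=\tilde f\varepsilon^{-3/2}$, and these can be chosen such that for $j=1,2$ $$\Big\|a^{(j)}_{\varepsilon,\kappa}-\lim_{|x|\to\infty}a^{(j)}_{\varepsilon,\kappa}(x)\Big\|_{H^2(\mathbb R)}\to\infty\quad\text{as }\varepsilon\to0,\ \text{uniformly with respect to }\kappa\in(0,\kappa_0).$$ Here an even homoclinic solution is a nonconstant even twice continuously differentiable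 solution of the form $a=\tilde a+a^\infty$ with $a^\infty=\lim_{|x|\to\infty}a(x)\in\mathbb C$ and $\tilde a\in H^2(\mathbb R;\mathbb C)$. -/

import Mathlib

open scoped ContDiff Topology

noncomputable section

namespace LugiatoLefever

open MeasureTheory Filter

/-- `v` is a weak derivative of `u` on the real line: both are locally integrable and
`∫ φ' u = - ∫ φ v` for all real-valued test functions `φ`. -/
def IsWeakDeriv (u v : ℝ → ℂ) : Prop :=
  LocallyIntegrable u ∧ LocallyIntegrable v ∧
    ∀ φ : ℝ → ℝ, ContDiff ℝ ∞ φ → HasCompactSupport φ →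
      ∫ x, deriv φ x • u x = -∫ x, φ x • v x

/-- Weak derivatives are unique almost everywhere. -/
theorem IsWeakDeriv.ae_eq {u u' v w : ℝ → ℂ} (hv : IsWeakDeriv u v) (hw : IsWeakDeriv u' w)
    (hu : u =ᵐ[volume] u') : v =ᵐ[volume] w := by
  refine ae_eq_of_integral_contDiff_smul_eq hv.2.1 hw.2.1 fun φ h1 h2 => ?_
  have e : ∫ x, deriv φ x • u x = ∫ x, deriv φ x • u' x :=
    integral_congr_ae (hu.mono fun x hx => by simp only [hx])
  have := hv.2.2 φ h1 h2
  rw [e, hw.2.2 φ h1 h2] at this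
  exact (neg_injective this).symm

/-- Membership in the Sobolev space `H²(ℝ; ℂ)`: the function and its weak derivatives of first
and second order are square integrable. -/
def MemH2 (u : ℝ → ℂ) : Prop :=
  MemLp u 2 ∧ ∃ v w : ℝ → ℂ, IsWeakDeriv u v ∧ IsWeakDeriv v w ∧ MemLp v 2 ∧ MemLp w 2

open Classical in
/-- A chosen weak derivative of `u` (zero if there is none); unique almost everywhere. -/
def weakDeriv (u : ℝ → ℂ) : ℝ → ℂ :=
  if h : ∃ v, IsWeakDeriv u v then h.choose else 0

/-- The norm of `H²(ℝ; ℂ)`, meaningful for functions with `MemH2`. -/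
def h2Norm (u : ℝ → ℂ) : ℝ :=
  Real.sqrt ((∫ x, ‖u x‖ ^ 2) + (∫ x, ‖weakDeriv u x‖ ^ 2) +
    ∫ x, ‖weakDeriv (weakDeriv u) x‖ ^ 2)

theorem isWeakDeriv_weakDeriv {u v : ℝ → ℂ} (h : IsWeakDeriv u v) :
    IsWeakDeriv u (weakDeriv u) := by
  have h' : ∃ v, IsWeakDeriv u v := ⟨v, h⟩
  rw [weakDeriv, dif_pos h']
  exact h'.choose_spec

theorem IsWeakDeriv.congr_left {u u' v : ℝ → ℂ} (h : IsWeakDeriv u v)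
    (hu : u =ᵐ[volume] u') : IsWeakDeriv u' v := by
  refine ⟨fun x => ?_, h.2.1, fun φ h1 h2 => ?_⟩
  · obtain ⟨s, hs, hi⟩ := h.1 x
    exact ⟨s, hs, hi.congr (ae_restrict_of_ae hu)⟩
  rw [← h.2.2 φ h1 h2]
  exact integral_congr_ae (hu.mono fun x hx => by simp only [hx])

/-- The norm can be computed from any weak derivatives. -/
theorem h2Norm_eq {u v w : ℝ → ℂ} (hv : IsWeakDeriv u v) (hw : IsWeakDeriv v w) :
    h2Norm u = Real.sqrt ((∫ x, ‖u x‖ ^ 2) + (∫ x, ‖v x‖ ^ 2) + ∫ x, ‖w x‖ ^ 2) := by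
  have e1 : weakDeriv u =ᵐ[volume] v :=
    (isWeakDeriv_weakDeriv hv).ae_eq hv (ae_eq_refl _)
  have e2 : weakDeriv (weakDeriv u) =ᵐ[volume] w :=
    (isWeakDeriv_weakDeriv (hw.congr_left e1.symm)).ae_eq hw e1
  rw [h2Norm, integral_congr_ae (e1.mono fun x hx => by simp only [hx] :
      (fun x => ‖weakDeriv u x‖ ^ 2) =ᵐ[volume] fun x => ‖v x‖ ^ 2),
    integral_congr_ae (e2.mono fun x hx => by simp only [hx] :
      (fun x => ‖weakDeriv (weakDeriv u) x‖ ^ 2) =ᵐ[volume] fun x => ‖w x‖ ^ 2)]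

/-- `a : ℝ → ℂ` is an even homoclinic solution, with limit `aInf` at `±∞`, of the stationary
Lugiato–Lefever equation with nonlinear damping `κ`,
`-d a'' - (i - ζ) a - (1 + iκ) |a|² a + i f = 0` on `ℝ`, `a'(0) = 0`:
a classical, even, nonconstant solution of the form `a = ã + aInf` with `ã ∈ H²(ℝ; ℂ)`. -/
structure IsEvenHomoclinic (d ζ f κ : ℝ) (a : ℝ → ℂ) (aInf : ℂ) : Prop where
  contDiff : ContDiff ℝ 2 a
  equation : ∀ x : ℝ,
    -(d : ℂ) * deriv (deriv a) x - (Complex.I - (ζ : ℂ)) * a x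
      - (1 + Complex.I * (κ : ℂ)) * (‖a x‖ : ℂ) ^ 2 * a x + Complex.I * (f : ℂ) = 0
  deriv_zero : deriv a 0 = 0
  even : ∀ x : ℝ, a (-x) = a x
  tendsto : Tendsto a (cocompact ℝ) (𝓝 aInf)
  memH2 : MemH2 (fun x => a x - aInf)
  nonconstant : ∃ x : ℝ, a x ≠ aInf

end LugiatoLefever

end

/-!
With `k = ε^{-1/2}` and `a(x) = i k w(k x)`, the equation becomes
`d w'' = (ζ - i ε) w - (1 + i κ) |w|² w + f` with fixed `ζ` and `f`, a small perturbation of the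
equation `d w'' = ζ w - w³ + f` for real `w`. If `w₀` is the middle root of `ζ t - t³ + f`, the
latter has two even solutions homoclinic to `w₀`, in closed form: `(w - w₀)⁻¹` is a constant plus a
multiple of `cosh`, and the sign of the multiple distinguishes them (`exists_isHomoclinicProfile`).

These profiles persist. Writing the system for the real and imaginary parts as a fixed point problem
on bounded continuous functions by means of the resolvent of `∂²` composed with `h ↦ h(|x|)`, whose
fixed points are automatically even, the derivative at the profile is diagonal, each entry being the
identity minus a compact operator (`isCompactOperator_resolvent_mul`). By the Fredholm alternative
it is onto as soon as the two linearizations `-d ∂² + ζ - 3 w²` and `-d ∂² + ζ - w²` have no bounded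
even kernel. For the first this follows from the Wronskian with the odd kernel element `w'`
(`real_kernel_eq_zero`). For the second, Sturm comparison with `w'` shows that a kernel element has
no zeros on the half-line `x ≥ 0`, while `d (w' φ - φ' w)' = f φ` with `f ≠ 0` shows that it must
have one (`imag_kernel_eq_zero`); for `f = 0` the phase invariance of the equation makes `w` itself
a kernel element. Hence solutions of the perturbed system exist uniformly close to the profile
(`exists_perturbed_profile`).

Since `w₀` is a hyperbolic equilibrium, the squared distance of such a solution to the nearby
equilibrium of the perturbed system satisfies a differential inequality `E'' ≥ m² E` near infinity,
and therefore decays exponentially (`exists_decaying_profile`), which gives membership in `H²`.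
Undoing the scaling multiplies the squared `L²` norm of `w - w(∞)` by `k = ε^{-1/2}`, while the
norm before scaling is bounded below uniformly in both parameters (`exists_branch`); so the `H²`
norm blows up.
-/

open scoped ContDiff Topology BoundedContinuousFunction

noncomputable section

namespace LugiatoLefever

open MeasureTheory Filter

/-! ### Decay and uniqueness for second order linear equations -/

/-- A function with `p'' ≥ m² p` on a half-line that is bounded above there decays exponentially:
the growing mode would show up as a positive value of `p' + m p`. -/
theorem le_exp_decay_of_sq_mul_le {p p' p'' : ℝ → ℝ} {m R M : ℝ} (hm : 0 < m)
    (h1 : ∀ x, HasDerivAt p (p' x) x) (h2 : ∀ x, HasDerivAt p' (p'' x) x)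
    (h : ∀ x, R ≤ x → m ^ 2 * p x ≤ p'' x) (hM : ∀ x, R ≤ x → p x ≤ M) {x : ℝ} (hx : R ≤ x) :
    p x ≤ p R * Real.exp (-m * (x - R)) := by
  have hexp : ∀ a x : ℝ, HasDerivAt (fun x => Real.exp (a * x)) (Real.exp (a * x) * a) x := by
    intro a x
    simpa using ((hasDerivAt_id x).const_mul a).exp
  -- `e^{-mx} (p' + m p)` is monotone
  have hv : MonotoneOn (fun x => Real.exp (-m * x) * (p' x + m * p x)) (Set.Ici R) := by
    have hd : ∀ x, HasDerivAt (fun x => Real.exp (-m * x) * (p' x + m * p x))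
        (Real.exp (-m * x) * (p'' x - m ^ 2 * p x)) x := by
      intro x
      refine ((hexp (-m) x).mul ((h2 x).add ((h1 x).const_mul m))).congr_deriv ?_
      simp only [Pi.add_apply]
      ring
    refine monotoneOn_of_deriv_nonneg (convex_Ici R)
      (fun x _ => (hd x).continuousAt.continuousWithinAt)
      (fun x _ => (hd x).differentiableAt.differentiableWithinAt) fun x hx => ?_
    rw [interior_Ici] at hx
    rw [(hd x).deriv]
    exact mul_nonneg (Real.exp_pos _).le (sub_nonneg.2 (h x (le_of_lt hx)))
  have hq : ∀ x, HasDerivAt (fun x => Real.exp (m * x) * p x)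
      (Real.exp (m * x) * (p' x + m * p x)) x := by
    intro x
    refine ((hexp m x).mul (h1 x)).congr_deriv ?_
    ring
  have hneg : ∀ x, R ≤ x → p' x + m * p x ≤ 0 := by
    intro y hy
    by_contra! hpos
    set c := Real.exp (-m * y) * (p' y + m * p y) with hc
    have hc0 : 0 < c := mul_pos (Real.exp_pos _) hpos
    -- then `p` grows at least like `e^{mx}`
    have hmon : MonotoneOn (fun x => Real.exp (m * x) * p x - c / (2 * m) * Real.exp (2 * m * x))
        (Set.Ici y) := by
      have hd : ∀ x, HasDerivAt
          (fun x => Real.exp (m * x) * p x - c / (2 * m) * Real.exp (2 * m * x))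
          (Real.exp (m * x) * (p' x + m * p x) - c * Real.exp (2 * m * x)) x := by
        intro x
        refine ((hq x).sub ((hexp (2 * m) x).const_mul (c / (2 * m)))).congr_deriv ?_
        field_simp
      refine monotoneOn_of_deriv_nonneg (convex_Ici y)
        (fun x _ => (hd x).continuousAt.continuousWithinAt)
        (fun x _ => (hd x).differentiableAt.differentiableWithinAt) fun x hx => ?_
      rw [interior_Ici] at hx
      rw [(hd x).deriv]
      have h3 : c ≤ Real.exp (-m * x) * (p' x + m * p x) :=
        hv hy (hy.trans (le_of_lt hx)) (le_of_lt hx)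
      have h4 : Real.exp (m * x) * (p' x + m * p x)
          = Real.exp (2 * m * x) * (Real.exp (-m * x) * (p' x + m * p x)) := by
        rw [← mul_assoc, ← Real.exp_add]; ring_nf
      rw [h4, sub_nonneg, mul_comm c]
      exact mul_le_mul_of_nonneg_left h3 (Real.exp_pos _).le
    have ht : Tendsto (fun x => c / (2 * m) * Real.exp (m * x)) atTop atTop :=
      (Real.tendsto_exp_atTop.comp (tendsto_id.const_mul_atTop hm)).const_mul_atTop (by positivity)
    set K := Real.exp (m * y) * p y - c / (2 * m) * Real.exp (2 * m * y) with hK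
    have hev := (ht.eventually_gt_atTop (M + |K|)).and
      ((eventually_ge_atTop y).and (eventually_ge_atTop 0))
    obtain ⟨x, hx1, hx2, hx3⟩ := hev.exists
    have h5 : K ≤ Real.exp (m * x) * p x - c / (2 * m) * Real.exp (2 * m * x) :=
      hmon Set.self_mem_Ici hx2 hx2
    have h6 : Real.exp (2 * m * x) = Real.exp (m * x) * Real.exp (m * x) := by
      rw [← Real.exp_add]; ring_nf
    have h7 : 1 ≤ Real.exp (m * x) := Real.one_le_exp (by positivity)
    have h8 : p x ≤ M := hM x (hy.trans hx2)
    have h9 : Real.exp (m * x) * (p x - c / (2 * m) * Real.exp (m * x))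
        < Real.exp (m * x) * (-|K|) :=
      mul_lt_mul_of_pos_left (by linarith) (Real.exp_pos _)
    have h10 : Real.exp (m * x) * (-|K|) ≤ -|K| := by nlinarith [abs_nonneg K]
    have h11 := neg_abs_le K
    rw [h6] at h5
    nlinarith
  have hanti : AntitoneOn (fun x => Real.exp (m * x) * p x) (Set.Ici R) := by
    refine antitoneOn_of_deriv_nonpos (convex_Ici R)
      (fun x _ => (hq x).continuousAt.continuousWithinAt)
      (fun x _ => (hq x).differentiableAt.differentiableWithinAt) fun x hx => ?_
    rw [interior_Ici] at hx
    rw [(hq x).deriv]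
    exact mul_nonpos_of_nonneg_of_nonpos (Real.exp_pos _).le (hneg x (le_of_lt hx))
  have h3 : Real.exp (m * x) * p x ≤ Real.exp (m * R) * p R := hanti Set.self_mem_Ici hx hx
  have h4 : Real.exp (-m * (x - R)) = Real.exp (m * R) / Real.exp (m * x) := by
    rw [← Real.exp_sub]; ring_nf
  rw [h4, mul_div_assoc', le_div_iff₀ (Real.exp_pos _)]
  linarith

/-- Exponential decay of a bounded function with `φ φ'' ≥ m² φ²` on a half-line, such as a bounded
solution of `φ'' = Q φ` with `Q ≥ m²`. -/
theorem sq_le_exp_decay {φ φ' φ'' : ℝ → ℝ} {m R M : ℝ} (hm : 0 < m)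
    (h1 : ∀ x, HasDerivAt φ (φ' x) x) (h2 : ∀ x, HasDerivAt φ' (φ'' x) x)
    (h : ∀ x, R ≤ x → m ^ 2 * φ x ^ 2 ≤ φ x * φ'' x) (hM : ∀ x, R ≤ x → |φ x| ≤ M)
    {x : ℝ} (hx : R ≤ x) :
    φ x ^ 2 ≤ φ R ^ 2 * Real.exp (-m * (x - R)) := by
  refine le_exp_decay_of_sq_mul_le (p := fun x => φ x ^ 2) (p' := fun x => 2 * φ x * φ' x)
    (p'' := fun x => 2 * φ' x * φ' x + 2 * φ x * φ'' x) (M := M ^ 2) hm (fun x => ?_)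
    (fun x => ?_) (fun x hx => ?_) (fun x hx => sq_le_sq' (by linarith [neg_abs_le (φ x), hM x hx])
      ((le_abs_self _).trans (hM x hx))) hx
  · exact ((h1 x).pow 2).congr_deriv (by simp)
  · exact ((h1 x).const_mul 2).mul (h2 x)
  · nlinarith [h x hx, mul_self_nonneg (φ' x), mul_nonneg (sq_nonneg m) (sq_nonneg (φ x))]

/-- The only bounded solution of `u'' = m² u` on the line is zero. -/
theorem eq_zero_of_bounded_of_deriv2_eq {u u' : ℝ → ℝ} {m M : ℝ} (hm : 0 < m)
    (h1 : ∀ x, HasDerivAt u (u' x) x) (h2 : ∀ x, HasDerivAt u' (m ^ 2 * u x) x)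
    (hM : ∀ x, |u x| ≤ M) (x : ℝ) : u x = 0 := by
  have hle : ∀ R, R ≤ x → u x ^ 2 ≤ M ^ 2 * Real.exp (-m * (x - R)) := fun R hR =>
    (sq_le_exp_decay hm h1 h2 (fun y _ => by nlinarith) (fun y _ => hM y) hR).trans
      (mul_le_mul_of_nonneg_right (sq_le_sq' (by linarith [neg_abs_le (u R), hM R])
        ((le_abs_self _).trans (hM R))) (Real.exp_pos _).le)
  have ht : Tendsto (fun R => M ^ 2 * Real.exp (-m * (x - R))) atBot (𝓝 (M ^ 2 * 0)) := by
    refine (Real.tendsto_exp_atBot.comp ?_).const_mul _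
    have : (fun R => -m * (x - R)) = fun R => m * R + (-m * x) := by ext; ring
    rw [this]
    exact tendsto_atBot_add_const_right _ _ (tendsto_id.const_mul_atBot hm)
  have h0 := ge_of_tendsto ht (eventually_atBot.2 ⟨x, fun R hR => hle R hR⟩)
  have : u x ^ 2 = 0 := le_antisymm (by simpa using h0) (sq_nonneg _)
  simpa using this

/-- Interpolation: bounds on `φ` and `φ''` over a unit interval bound `φ'`. -/
theorem abs_deriv_le_of_abs_le {φ φ' φ'' : ℝ → ℝ} {x B : ℝ}
    (h1 : ∀ x, HasDerivAt φ (φ' x) x) (h2 : ∀ x, HasDerivAt φ' (φ'' x) x)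
    (hφ : ∀ y, x ≤ y → |φ y| ≤ B) (hφ'' : ∀ y, x ≤ y → |φ'' y| ≤ B) : |φ' x| ≤ 3 * B := by
  obtain ⟨ξ, hξ, e1⟩ := exists_hasDerivAt_eq_slope φ φ' (lt_add_one x)
    (fun y _ => (h1 y).continuousAt.continuousWithinAt) fun y _ => h1 y
  obtain ⟨η, hη, e2⟩ := exists_hasDerivAt_eq_slope φ' φ'' hξ.1
    (fun y _ => (h2 y).continuousAt.continuousWithinAt) fun y _ => h2 y
  have e1' : φ' ξ = φ (x + 1) - φ x := by rw [e1]; simp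
  have e2' : φ' x = φ' ξ - φ'' η * (ξ - x) := by
    rw [e2]; field_simp [sub_ne_zero.2 hξ.1.ne']; ring
  have b0 := abs_le.1 (hφ x le_rfl)
  have b1 := abs_le.1 (hφ (x + 1) (by linarith))
  have b2 := hφ'' η hη.1.le
  have b3 : |φ'' η * (ξ - x)| ≤ B := by
    rw [abs_mul, abs_of_pos (sub_pos.2 hξ.1)]
    have := hξ.2
    have := hξ.1
    nlinarith [abs_nonneg (φ'' η)]
  have b3 := abs_le.1 b3
  rw [e2', e1', abs_le]
  constructor <;> linarith

theorem tendsto_deriv_zero {φ φ' φ'' : ℝ → ℝ}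
    (h1 : ∀ x, HasDerivAt φ (φ' x) x) (h2 : ∀ x, HasDerivAt φ' (φ'' x) x)
    (hφ : Tendsto φ atTop (𝓝 0)) (hφ'' : Tendsto φ'' atTop (𝓝 0)) :
    Tendsto φ' atTop (𝓝 0) := by
  rw [Metric.tendsto_atTop] at *
  intro ε hε
  obtain ⟨N1, hN1⟩ := hφ (ε / 4) (by linarith)
  obtain ⟨N2, hN2⟩ := hφ'' (ε / 4) (by linarith)
  refine ⟨max N1 N2, fun x hx => ?_⟩
  have := abs_deriv_le_of_abs_le (B := ε / 4) h1 h2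
    (fun y hy => by simpa using (hN1 y ((le_max_left _ _).trans (hx.trans hy))).le)
    (fun y hy => by simpa using (hN2 y ((le_max_right _ _).trans (hx.trans hy))).le)
  rw [Real.dist_eq, sub_zero]
  linarith

/-- Backward uniqueness for `φ'' = Q φ` with bounded `Q`, by the energy `φ² + φ'²`. -/
theorem eq_zero_of_le_of_initial_zero {φ φ' Q : ℝ → ℝ} {z M : ℝ}
    (h1 : ∀ x, HasDerivAt φ (φ' x) x) (h2 : ∀ x, HasDerivAt φ' (Q x * φ x) x)
    (hQ : ∀ x, |Q x| ≤ M) (hz : φ z = 0) (hz' : φ' z = 0) {x : ℝ} (hx : x ≤ z) : φ x = 0 := by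
  have hd : ∀ x, HasDerivAt (fun x => Real.exp ((1 + M) * x) * (φ x ^ 2 + φ' x ^ 2))
      (Real.exp ((1 + M) * x) *
        ((1 + M) * (φ x ^ 2 + φ' x ^ 2) + 2 * φ x * φ' x * (1 + Q x))) x := by
    intro x
    refine ((((hasDerivAt_id x).const_mul (1 + M)).exp).mul
      (((h1 x).pow 2).add ((h2 x).pow 2))).congr_deriv ?_
    simp only [Pi.add_apply, Pi.pow_apply, id]
    ring
  have hmon : Monotone (fun x => Real.exp ((1 + M) * x) * (φ x ^ 2 + φ' x ^ 2)) := by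
    refine monotone_of_deriv_nonneg (fun x => (hd x).differentiableAt) fun x => ?_
    rw [(hd x).deriv]
    refine mul_nonneg (Real.exp_pos _).le ?_
    have hq := abs_le.1 (hQ x)
    nlinarith [mul_nonneg (sub_nonneg.2 hq.2) (sq_nonneg (φ x - φ' x)),
      mul_nonneg (by linarith : 0 ≤ Q x + M) (sq_nonneg (φ x + φ' x)), sq_nonneg (φ x + φ' x)]
  have := hmon hx
  simp only [hz, hz', ne_eq, OfNat.ofNat_ne_zero, not_false_eq_true, zero_pow, add_zero,
    mul_zero] at this
  have h3 := Real.exp_pos ((1 + M) * x)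
  have h4 : φ x ^ 2 + φ' x ^ 2 ≤ 0 := by
    by_contra! hc
    exact absurd (mul_pos h3 hc) (not_lt.2 this)
  nlinarith [sq_nonneg (φ x), sq_nonneg (φ' x)]

/-- If `Q → q > 0` at infinity, then bounded solutions of `φ'' = Q φ` tend to zero together with
their derivative, and a zero sufficiently far out is followed by zeros only. -/
theorem tendsto_zero_of_deriv2_eq {φ φ' Q : ℝ → ℝ} {q M : ℝ} (hq : 0 < q)
    (h1 : ∀ x, HasDerivAt φ (φ' x) x) (h2 : ∀ x, HasDerivAt φ' (Q x * φ x) x)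
    (hQ : Tendsto Q atTop (𝓝 q)) (hM : ∀ x, |φ x| ≤ M) :
    Tendsto φ atTop (𝓝 0) ∧ Tendsto φ' atTop (𝓝 0) ∧
      ∃ R, ∀ z, R ≤ z → φ z = 0 → ∀ x, z ≤ x → φ x = 0 := by
  obtain ⟨R, hR⟩ := eventually_atTop.1 (hQ.eventually_const_lt (half_lt_self hq))
  have hm : 0 < Real.sqrt (q / 2) := Real.sqrt_pos.2 (half_pos hq)
  have hm2 : Real.sqrt (q / 2) ^ 2 = q / 2 := Real.sq_sqrt (half_pos hq).le
  have key : ∀ z, R ≤ z → ∀ x, z ≤ x →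
      φ x ^ 2 ≤ φ z ^ 2 * Real.exp (-Real.sqrt (q / 2) * (x - z)) := by
    intro z hz x hx
    refine sq_le_exp_decay hm h1 h2 (fun y hy => ?_) (fun y _ => hM y) hx
    rw [hm2]
    nlinarith [hR y (hz.trans hy), sq_nonneg (φ y)]
  have hφ : Tendsto φ atTop (𝓝 0) := by
    have ht : Tendsto (fun x => φ R ^ 2 * Real.exp (-Real.sqrt (q / 2) * (x - R))) atTop
        (𝓝 (φ R ^ 2 * 0)) := by
      refine (Real.tendsto_exp_atBot.comp ?_).const_mul _
      have : (fun x => -Real.sqrt (q / 2) * (x - R))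
          = fun x => -Real.sqrt (q / 2) * x + Real.sqrt (q / 2) * R := by ext; ring
      rw [this]
      exact tendsto_atBot_add_const_right _ _ (tendsto_id.const_mul_atTop_of_neg (by linarith))
    rw [mul_zero] at ht
    have hs : Tendsto (fun x => φ x ^ 2) atTop (𝓝 0) :=
      squeeze_zero' (Eventually.of_forall fun x => sq_nonneg _)
        (eventually_atTop.2 ⟨R, fun x hx => key R le_rfl x hx⟩) ht
    have := hs.sqrt
    simp only [Real.sqrt_sq_eq_abs, Real.sqrt_zero] at this
    exact (tendsto_zero_iff_abs_tendsto_zero φ).2 this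
  refine ⟨hφ, tendsto_deriv_zero h1 h2 hφ (by simpa using hQ.mul hφ), R, fun z hz h0 x hx => ?_⟩
  have := key z hz x hx
  rw [h0] at this
  nlinarith [sq_nonneg (φ x)]

/-! ### Nondegeneracy of a homoclinic profile -/

/-- A real profile `w` homoclinic to `w₀`: an even bounded solution of `d w'' = ζ w - w³ + f`
tending to `w₀` at infinity, strictly monotone on the positive half-line (increasing or decreasing
according to the sign of `s`), with `w''(0) ≠ 0`. The derivative `w'` is carried along as data. -/
structure IsHomoclinicProfile (d ζ f w₀ s : ℝ) (w w' : ℝ → ℝ) : Prop where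
  hasDerivAt : ∀ x, HasDerivAt w (w' x) x
  hasDerivAt' : ∀ x, HasDerivAt w' ((ζ * w x - w x ^ 3 + f) / d) x
  even : ∀ x, w (-x) = w x
  deriv_zero : w' 0 = 0
  deriv2_ne_zero : ζ * w 0 - w 0 ^ 3 + f ≠ 0
  sign : ∀ x, 0 < x → 0 < s * w' x
  bounded : ∃ M, ∀ x, |w x| ≤ M
  tendsto : Tendsto w atTop (𝓝 w₀)
  equilibrium : ζ * w₀ - w₀ ^ 3 + f = 0

namespace IsHomoclinicProfile

variable {d ζ f w₀ s : ℝ} {w w' : ℝ → ℝ}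

theorem tendsto_deriv2 (H : IsHomoclinicProfile d ζ f w₀ s w w') :
    Tendsto (fun x => (ζ * w x - w x ^ 3 + f) / d) atTop (𝓝 0) := by
  have := (((H.tendsto.const_mul ζ).sub (H.tendsto.pow 3)).add_const f).div_const d
  rwa [H.equilibrium, zero_div] at this

theorem tendsto_deriv (H : IsHomoclinicProfile d ζ f w₀ s w w') : Tendsto w' atTop (𝓝 0) := by
  refine tendsto_deriv_zero (φ := fun x => w x - w₀) (fun x => (H.hasDerivAt x).sub_const _)
    H.hasDerivAt' ?_ H.tendsto_deriv2
  simpa using H.tendsto.sub_const w₀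

theorem bounded_quadratic (H : IsHomoclinicProfile d ζ f w₀ s w w') (k : ℝ) :
    ∃ M, ∀ x, |(ζ - k * w x ^ 2) / d| ≤ M := by
  obtain ⟨M, hM⟩ := H.bounded
  refine ⟨(|ζ| + |k| * M ^ 2) / |d|, fun x => ?_⟩
  rw [abs_div]
  gcongr
  refine (abs_sub _ _).trans ?_
  rw [abs_mul, abs_pow]
  gcongr
  exact hM x

theorem tendsto_quadratic (H : IsHomoclinicProfile d ζ f w₀ s w w') (k : ℝ) :
    Tendsto (fun x => (ζ - k * w x ^ 2) / d) atTop (𝓝 ((ζ - k * w₀ ^ 2) / d)) :=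
  (((H.tendsto.pow 2).const_mul k).const_sub ζ).div_const d

/-- The linearization `-d ∂² + ζ - 3 w²` in the real direction has no bounded even kernel: the
Wronskian with the kernel element `w'` vanishes, which at `x = 0` reads `φ(0) w''(0) = 0`. -/
theorem real_kernel_eq_zero (H : IsHomoclinicProfile d ζ f w₀ s w w') (hd : 0 < d)
    (hq : 0 < ζ - 3 * w₀ ^ 2) {φ φ' : ℝ → ℝ} {M : ℝ}
    (h1 : ∀ x, HasDerivAt φ (φ' x) x)
    (h2 : ∀ x, HasDerivAt φ' ((ζ - 3 * w x ^ 2) / d * φ x) x)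
    (hM : ∀ x, |φ x| ≤ M) (heven : ∀ x, φ (-x) = φ x) (h0 : φ' 0 = 0) (x : ℝ) : φ x = 0 := by
  obtain ⟨l1, l2, -⟩ :=
    tendsto_zero_of_deriv2_eq (div_pos hq hd) h1 h2 (H.tendsto_quadratic 3) hM
  have hW : ∀ x, HasDerivAt (fun x => φ' x * w' x - φ x * ((ζ * w x - w x ^ 3 + f) / d)) 0 x := by
    intro x
    refine (((h2 x).mul (H.hasDerivAt' x)).sub ((h1 x).mul
      (((((H.hasDerivAt x).const_mul ζ).sub ((H.hasDerivAt x).pow 3)).add_const f).div_const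
        d))).congr_deriv ?_
    simp
    field_simp
    ring
  have hlim : Tendsto (fun x => φ' x * w' x - φ x * ((ζ * w x - w x ^ 3 + f) / d)) atTop
      (𝓝 0) := by
    simpa using (l2.mul H.tendsto_deriv).sub (l1.mul H.tendsto_deriv2)
  have hconst := is_const_of_deriv_eq_zero (fun x => (hW x).differentiableAt)
    fun x => (hW x).deriv
  have hW0 : φ' 0 * w' 0 - φ 0 * ((ζ * w 0 - w 0 ^ 3 + f) / d) = 0 := by
    refine tendsto_nhds_unique (tendsto_const_nhds.congr fun x => ?_) hlim
    exact hconst 0 x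
  have hφ0 : φ 0 = 0 := by
    rw [h0, zero_mul, zero_sub, neg_eq_zero] at hW0
    exact (mul_eq_zero.1 hW0).resolve_right (div_ne_zero H.deriv2_ne_zero hd.ne')
  obtain ⟨Mq, hMq⟩ := H.bounded_quadratic 3
  have hneg : ∀ x ≤ 0, φ x = 0 := fun x hx =>
    eq_zero_of_le_of_initial_zero h1 h2 hMq hφ0 h0 hx
  rcases le_total x 0 with hx | hx
  · exact hneg x hx
  · rw [← heven]; exact hneg _ (by linarith)

/-- Sturm comparison: a decaying solution of `d φ'' = (ζ - w²) φ` that vanishes at `z ≥ 0` cannot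
be positive beyond, since the Wronskian with `w'`, a solution of `d v'' = (ζ - 3 w²) v` of constant
sign, is monotone. -/
theorem not_pos_of_zero (H : IsHomoclinicProfile d ζ f w₀ s w w') (hd : 0 < d) (hw₀ : w₀ ≠ 0)
    {φ φ' : ℝ → ℝ} {z : ℝ} (h1 : ∀ x, HasDerivAt φ (φ' x) x)
    (h2 : ∀ x, HasDerivAt φ' ((ζ - w x ^ 2) / d * φ x) x)
    (l1 : Tendsto φ atTop (𝓝 0)) (l2 : Tendsto φ' atTop (𝓝 0)) (hz : 0 ≤ z) (h0 : φ z = 0) :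
    ¬ ∀ x, z < x → 0 < φ x := by
  intro hpos
  set W : ℝ → ℝ := fun x => s * (φ' x * w' x - φ x * ((ζ * w x - w x ^ 3 + f) / d)) with hWdef
  have hW : ∀ x, HasDerivAt W (2 / d * w x ^ 2 * (s * w' x) * φ x) x := by
    intro x
    refine ((((h2 x).mul (H.hasDerivAt' x)).sub ((h1 x).mul
      (((((H.hasDerivAt x).const_mul ζ).sub ((H.hasDerivAt x).pow 3)).add_const f).div_const
        d))).const_mul s).congr_deriv ?_
    simp
    field_simp
    ring
  have hlim : Tendsto W atTop (𝓝 0) := by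
    simpa using ((l2.mul H.tendsto_deriv).sub (l1.mul H.tendsto_deriv2)).const_mul s
  have hmon : MonotoneOn W (Set.Ici z) := by
    refine monotoneOn_of_deriv_nonneg (convex_Ici z)
      (fun x _ => (hW x).continuousAt.continuousWithinAt)
      (fun x _ => (hW x).differentiableAt.differentiableWithinAt) fun x hx => ?_
    rw [interior_Ici] at hx
    rw [(hW x).deriv]
    have := hpos x hx
    have := H.sign x (lt_of_le_of_lt hz hx)
    positivity
  have hφ'z : 0 ≤ φ' z := by
    refine ge_of_tendsto ((h1 z).tendsto_slope.mono_left
      (nhdsWithin_mono z (s := Set.Ioi z) fun y (hy : z < y) => ne_of_gt hy)) ?_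
    filter_upwards [self_mem_nhdsWithin] with y hy
    rw [slope_def_field, h0, sub_zero]
    exact div_nonneg (hpos y hy).le (sub_pos.2 hy).le
  have hWz : 0 ≤ W z := by
    simp only [hWdef, h0, zero_mul, sub_zero]
    rcases hz.eq_or_lt with rfl | hz'
    · simp [H.deriv_zero]
    · nlinarith [mul_nonneg hφ'z (H.sign z hz').le]
  have hW0 : ∀ x, z ≤ x → W x = 0 := by
    intro x hx
    refine le_antisymm (ge_of_tendsto hlim (eventually_atTop.2 ⟨x, fun y hy => ?_⟩))
      (hWz.trans (hmon Set.self_mem_Ici hx hx))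
    exact hmon hx (hx.trans hy : z ≤ y) hy
  -- so the Wronskian is constant beyond `z` and `w` would have to vanish there
  have hwz : ∀ x, z < x → w x = 0 := by
    intro x hx
    have e : W =ᶠ[𝓝 x] fun _ => 0 := by
      filter_upwards [lt_mem_nhds hx] with y hy using hW0 y (le_of_lt hy)
    have e2 := (hW x).unique ((hasDerivAt_const x (0 : ℝ)).congr_of_eventuallyEq e)
    have := (hpos x hx).ne'
    have := (H.sign x (lt_of_le_of_lt hz hx)).ne'
    have h2d : 2 / d ≠ 0 := by positivity
    simp_all
  refine hw₀ (tendsto_nhds_unique H.tendsto (tendsto_const_nhds.congr' ?_))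
  filter_upwards [eventually_gt_atTop z] with x hx using (hwz x hx).symm

/-- An even decaying solution of `d φ'' = (ζ - w²) φ` is not positive on the positive half-line,
since `d (w'φ - φ'w)' = f φ` would make `w'φ - φ'w` strictly monotone between two zeros. -/
theorem not_pos_of_even (H : IsHomoclinicProfile d ζ f w₀ s w w') (hd : 0 < d) (hf : f ≠ 0)
    {φ φ' : ℝ → ℝ} (h1 : ∀ x, HasDerivAt φ (φ' x) x)
    (h2 : ∀ x, HasDerivAt φ' ((ζ - w x ^ 2) / d * φ x) x)
    (l1 : Tendsto φ atTop (𝓝 0)) (l2 : Tendsto φ' atTop (𝓝 0)) (h0 : φ' 0 = 0) :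
    ¬ ∀ x, 0 < x → 0 < φ x := by
  intro hpos
  set W : ℝ → ℝ := fun x => d / f * (w' x * φ x - φ' x * w x) with hWdef
  have hW : ∀ x, HasDerivAt W (φ x) x := by
    intro x
    refine ((((H.hasDerivAt' x).mul (h1 x)).sub ((h2 x).mul (H.hasDerivAt x))).const_mul
      (d / f)).congr_deriv ?_
    field_simp
    ring
  have hlim : Tendsto W atTop (𝓝 0) := by
    simpa using ((H.tendsto_deriv.mul l1).sub (l2.mul H.tendsto)).const_mul (d / f)
  have hmon : StrictMonoOn W (Set.Ici 0) := by
    refine strictMonoOn_of_deriv_pos (convex_Ici 0)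
      (fun x _ => (hW x).continuousAt.continuousWithinAt) fun x hx => ?_
    rw [interior_Ici] at hx
    rw [(hW x).deriv]
    exact hpos x hx
  have hW0 : W 0 = 0 := by simp [hWdef, h0, H.deriv_zero]
  have hW1 : 0 < W 1 := hW0 ▸ hmon Set.self_mem_Ici (by simp) one_pos
  refine absurd (ge_of_tendsto hlim (eventually_atTop.2 ⟨1, fun y hy => ?_⟩)) (not_le.2 hW1)
  exact hmon.monotoneOn (by simp) (zero_le_one.trans hy : (0 : ℝ) ≤ y) hy

/-- The linearization `-d ∂² + ζ - w²` in the imaginary direction has no bounded even kernel: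
beyond its largest zero, or on the whole half-line, a kernel element would have a sign. -/
theorem imag_kernel_eq_zero (H : IsHomoclinicProfile d ζ f w₀ s w w') (hd : 0 < d) (hf : f ≠ 0)
    (hw₀ : w₀ ≠ 0) (hq : 0 < ζ - w₀ ^ 2) {φ φ' : ℝ → ℝ} {M : ℝ}
    (h1 : ∀ x, HasDerivAt φ (φ' x) x)
    (h2 : ∀ x, HasDerivAt φ' ((ζ - w x ^ 2) / d * φ x) x)
    (hM : ∀ x, |φ x| ≤ M) (h0 : φ' 0 = 0) (x : ℝ) : φ x = 0 := by
  have hQ : Tendsto (fun x => (ζ - w x ^ 2) / d) atTop (𝓝 ((ζ - w₀ ^ 2) / d)) := by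
    simpa using H.tendsto_quadratic 1
  obtain ⟨l1, l2, R, hR⟩ := tendsto_zero_of_deriv2_eq (div_pos hq hd) h1 h2 hQ hM
  have hcont : Continuous φ := continuous_iff_continuousAt.2 fun x => (h1 x).continuousAt
  -- a continuous function without zeros beyond `z` has a sign there
  have hsign : ∀ z, (∀ x, z < x → φ x ≠ 0) →
      (∀ x, z < x → 0 < φ x) ∨ ∀ x, z < x → 0 < -φ x := by
    intro z hz
    by_contra! hc
    obtain ⟨⟨a, ha, ha'⟩, b, hb, hb'⟩ := hc
    obtain ⟨c, hc, hc'⟩ := isPreconnected_Ioi.intermediate_value (s := Set.Ioi z) ha hb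
      hcont.continuousOn (show (0 : ℝ) ∈ Set.Icc (φ a) (φ b) from ⟨ha', by linarith⟩)
    exact hz c hc hc'
  have n1 : ∀ x, HasDerivAt (fun x => -φ x) (-φ' x) x := fun x => (h1 x).neg
  have n2 : ∀ x, HasDerivAt (fun x => -φ' x) ((ζ - w x ^ 2) / d * -φ x) x := fun x =>
    (h2 x).neg.congr_deriv (by ring)
  have m1 : Tendsto (fun x => -φ x) atTop (𝓝 0) := by simpa using l1.neg
  have m2 : Tendsto (fun x => -φ' x) atTop (𝓝 0) := by simpa using l2.neg
  by_cases hz : ∃ z, max R 0 ≤ z ∧ φ z = 0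
  · obtain ⟨z, hz, hz0⟩ := hz
    have htail := hR z ((le_max_left _ _).trans hz) hz0
    rcases le_total z x with hx | hx
    · exact htail x hx
    have hd0 : φ' (z + 1) = 0 := by
      have e : φ =ᶠ[𝓝 (z + 1)] fun _ => 0 := by
        filter_upwards [lt_mem_nhds (lt_add_one z)] with y hy using htail y (le_of_lt hy)
      exact (h1 _).unique ((hasDerivAt_const _ (0 : ℝ)).congr_of_eventuallyEq e)
    obtain ⟨Mq, hMq⟩ := H.bounded_quadratic 1
    simp only [one_mul] at hMq
    exact eq_zero_of_le_of_initial_zero h1 h2 hMq (htail _ (by linarith)) hd0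
      (by linarith : x ≤ z + 1)
  exfalso
  by_cases hZ : ∃ z, 0 ≤ z ∧ φ z = 0
  · set Z : Set ℝ := {z | 0 ≤ z ∧ φ z = 0} with hZdef
    have hbdd : BddAbove Z := by
      refine ⟨max R 0, fun y hy => ?_⟩
      by_contra! hlt
      exact hz ⟨y, hlt.le, hy.2⟩
    have hclosed : IsClosed Z :=
      (isClosed_le continuous_const continuous_id).inter (isClosed_eq hcont continuous_const)
    obtain ⟨hz0, hzφ⟩ := hclosed.csSup_mem hZ hbdd
    rcases hsign (sSup Z) fun y hy h => absurd
      (le_csSup hbdd ⟨hz0.trans (le_of_lt hy), h⟩) (not_le.2 hy) with h | h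
    · exact H.not_pos_of_zero hd hw₀ h1 h2 l1 l2 hz0 hzφ h
    · exact H.not_pos_of_zero hd hw₀ n1 n2 m1 m2 hz0 (by simp [hzφ]) h
  · push Not at hZ
    rcases hsign 0 fun y hy => hZ y (le_of_lt hy) with h | h
    · exact H.not_pos_of_even hd hf h1 h2 l1 l2 h0 h
    · exact H.not_pos_of_even hd hf n1 n2 m1 m2 (by simp [h0]) h

end IsHomoclinicProfile

/-! ### The resolvent of the second derivative on bounded functions -/


theorem integrable_exp_neg_mul_abs {m : ℝ} (hm : 0 < m) :
    Integrable fun t : ℝ => Real.exp (-m * |t|) := by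
  have h1 : IntegrableOn (fun t : ℝ => Real.exp (-m * |t|)) (Set.Iic 0) :=
    (integrableOn_exp_mul_Iic hm 0).congr_fun
      (fun t (ht : t ≤ 0) => by simp [abs_of_nonpos ht]) measurableSet_Iic
  have h2 : IntegrableOn (fun t : ℝ => Real.exp (-m * |t|)) (Set.Ioi 0) :=
    (integrableOn_exp_mul_Ioi (neg_lt_zero.2 hm) 0).congr_fun
      (fun t (ht : 0 < t) => by simp [abs_of_pos ht]) measurableSet_Ioi
  have := h1.union h2
  rwa [Set.Iic_union_Ioi, integrableOn_univ] at this

theorem integral_exp_neg_mul_abs {m : ℝ} (hm : 0 < m) :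
    ∫ t : ℝ, Real.exp (-m * |t|) = 2 / m := by
  rw [integral_comp_abs (f := fun t => Real.exp (-m * t)),
    integral_exp_mul_Ioi (neg_lt_zero.2 hm)]
  simp
  ring

/-- The bounded solution `u` of `m² u - u'' = h`, as convolution of `h` with the exponential
kernel. -/
def resolventFun (m : ℝ) (h : ℝ → ℝ) (x : ℝ) : ℝ :=
  1 / (2 * m) * ∫ t, Real.exp (-m * |t|) * h (x + t)

theorem integrable_exp_mul_bounded {m : ℝ} (hm : 0 < m) {h : ℝ → ℝ} (hc : Continuous h) {C : ℝ}
    (hC : ∀ x, |h x| ≤ C) : Integrable fun t => Real.exp (-m * |t|) * h t :=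
  (integrable_exp_neg_mul_abs hm).mul_bdd (c := C) hc.aestronglyMeasurable
    (Eventually.of_forall fun x => hC x)

theorem abs_resolventFun_le {m : ℝ} (hm : 0 < m) {h k : ℝ → ℝ} (hc : Continuous h)
    (kc : Continuous k) {C : ℝ} (hC : ∀ x, |k x| ≤ C) (hk : ∀ x, |h x| ≤ k x) (x : ℝ) :
    |resolventFun m h x| ≤ resolventFun m k x := by
  have hi : ∀ x, |h x| ≤ C := fun x => (hk x).trans ((le_abs_self _).trans (hC x))
  have hx : Continuous fun t => x + t := by fun_prop
  rw [resolventFun, resolventFun, abs_mul, abs_of_pos (by positivity)]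
  refine mul_le_mul_of_nonneg_left ?_ (by positivity)
  refine (abs_integral_le_integral_abs).trans (integral_mono
    (integrable_exp_mul_bounded hm (hc.comp hx) fun t => hi _).abs
    (integrable_exp_mul_bounded hm (kc.comp hx) fun t => hC _) fun t => ?_)
  simp only [abs_mul, Real.abs_exp]
  exact mul_le_mul_of_nonneg_left (hk _) (Real.exp_pos _).le

theorem resolventFun_const {m : ℝ} (hm : 0 < m) (C x : ℝ) :
    resolventFun m (fun _ => C) x = C / m ^ 2 := by
  rw [resolventFun, integral_mul_const, integral_exp_neg_mul_abs hm]
  field_simp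

theorem abs_resolventFun_le_norm {m : ℝ} (hm : 0 < m) (h : ℝ →ᵇ ℝ) (x : ℝ) :
    |resolventFun m h x| ≤ ‖h‖ / m ^ 2 :=
  (abs_resolventFun_le hm h.continuous continuous_const (C := ‖h‖) (by simp)
    h.norm_coe_le_norm x).trans_eq (resolventFun_const hm _ _)

theorem resolventFun_neg_of_even {m : ℝ} {h : ℝ → ℝ} (he : ∀ x, h (-x) = h x) (x : ℝ) :
    resolventFun m h (-x) = resolventFun m h x := by
  rw [resolventFun, resolventFun, ← integral_neg_eq_self]
  congr 2
  ext t
  rw [abs_neg, ← he (x + t), neg_add]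

theorem resolventFun_add {m : ℝ} (hm : 0 < m) {h k : ℝ → ℝ} (hc : Continuous h)
    (kc : Continuous k) {C D : ℝ} (hC : ∀ x, |h x| ≤ C) (hD : ∀ x, |k x| ≤ D) (x : ℝ) :
    resolventFun m (fun y => h y + k y) x = resolventFun m h x + resolventFun m k x := by
  have hx : Continuous fun t => x + t := by fun_prop
  have := integral_add (integrable_exp_mul_bounded hm (hc.comp hx) fun t => hC _)
    (integrable_exp_mul_bounded hm (kc.comp hx) fun t => hD _)
  simp only [Function.comp] at this
  simp only [resolventFun, mul_add, this]

theorem resolventFun_smul {m : ℝ} (h : ℝ → ℝ) (c x : ℝ) :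
    resolventFun m (fun y => c * h y) x = c * resolventFun m h x := by
  simp only [resolventFun, mul_left_comm _ c, integral_const_mul]

/-- The resolvent of a function vanishing at infinity vanishes at infinity. -/
theorem tendsto_resolventFun {m : ℝ} (hm : 0 < m) {h : ℝ → ℝ} (hc : Continuous h) {C : ℝ}
    (hC : ∀ x, |h x| ≤ C) (h0 : Tendsto h (cocompact ℝ) (𝓝 0)) :
    Tendsto (resolventFun m h) (cocompact ℝ) (𝓝 0) := by
  have : (cocompact ℝ).IsCountablyGenerated := by
    rw [cocompact_eq_atBot_atTop]; infer_instance
  have hint : Tendsto (fun x => ∫ t, Real.exp (-m * |t|) * h (x + t)) (cocompact ℝ)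
      (𝓝 (∫ _ : ℝ, (0 : ℝ))) := by
    refine tendsto_integral_filter_of_dominated_convergence (fun t => Real.exp (-m * |t|) * C)
      (Eventually.of_forall fun x => ?_) (Eventually.of_forall fun x => ?_)
      ((integrable_exp_neg_mul_abs hm).mul_const C) (Eventually.of_forall fun t => ?_)
    · exact Continuous.aestronglyMeasurable (by fun_prop)
    · refine Eventually.of_forall fun t => ?_
      rw [norm_mul, Real.norm_eq_abs, Real.abs_exp]
      exact mul_le_mul_of_nonneg_left (hC _) (Real.exp_pos _).le
    · have : Tendsto (fun x : ℝ => x + t) (cocompact ℝ) (cocompact ℝ) :=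
        (Homeomorph.addRight t).isClosedEmbedding.tendsto_cocompact
      simpa using (h0.comp this).const_mul (Real.exp (-m * |t|))
  have := hint.const_mul (1 / (2 * m))
  rwa [integral_zero, mul_zero] at this

/-- The first derivative of `resolventFun m h`, as the difference of two half-line integrals. -/
def resolventFun' (m : ℝ) (h : ℝ → ℝ) (x : ℝ) : ℝ :=
  1 / 2 * (Real.exp (m * x) * (∫ y in Set.Ioi x, Real.exp (-m * y) * h y) -
    Real.exp (-m * x) * ∫ y in Set.Iic x, Real.exp (m * y) * h y)

theorem hasDerivAt_resolventFun {m : ℝ} (hm : 0 < m) {h : ℝ → ℝ} (hc : Continuous h) {C : ℝ}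
    (hC : ∀ x, |h x| ≤ C) (x : ℝ) :
    HasDerivAt (resolventFun m h) (resolventFun' m h x) x ∧
      HasDerivAt (resolventFun' m h) (m ^ 2 * resolventFun m h x - h x) x := by
  set A : ℝ → ℝ := fun x => ∫ y in Set.Iic x, Real.exp (m * y) * h y with hA
  set B : ℝ → ℝ := fun x => ∫ y in Set.Ioi x, Real.exp (-m * y) * h y with hB
  have iA : ∀ x, IntegrableOn (fun y => Real.exp (m * y) * h y) (Set.Iic x) := fun x =>
    (integrableOn_exp_mul_Iic hm x).mul_bdd (c := C) hc.aestronglyMeasurable.restrict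
      (Eventually.of_forall fun x => hC x)
  have iB : ∀ x, IntegrableOn (fun y => Real.exp (-m * y) * h y) (Set.Ioi x) := fun x =>
    (integrableOn_exp_mul_Ioi (neg_lt_zero.2 hm) x).mul_bdd (c := C)
      hc.aestronglyMeasurable.restrict (Eventually.of_forall fun x => hC x)
  have hsplit : resolventFun m h = fun x =>
      1 / (2 * m) * (Real.exp (-m * x) * A x + Real.exp (m * x) * B x) := by
    ext x
    have hx : Continuous fun t => x + t := by fun_prop
    have e1 : ∫ t, Real.exp (-m * |t|) * h (x + t) = ∫ y, Real.exp (-m * |y - x|) * h y := by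
      rw [← integral_sub_right_eq_self _ x]
      simp
    have hint : Integrable fun y => Real.exp (-m * |y - x|) * h y := by
      have := (integrable_exp_mul_bounded hm (hc.comp hx) fun t => hC _).comp_sub_right x
      simpa using this
    rw [resolventFun, e1, ← intervalIntegral.integral_Iic_add_Ioi (b := x) hint.integrableOn
      hint.integrableOn, hA, hB, ← integral_const_mul, ← integral_const_mul]
    congr 2
    · refine setIntegral_congr_fun measurableSet_Iic fun y (hy : y ≤ x) => ?_
      rw [abs_of_nonpos (by linarith), ← mul_assoc, ← Real.exp_add]
      ring_nf
    · refine setIntegral_congr_fun measurableSet_Ioi fun y (hy : x < y) => ?_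
      rw [abs_of_pos (by linarith), ← mul_assoc, ← Real.exp_add]
      ring_nf
  have dA : ∀ x, HasDerivAt A (Real.exp (m * x) * h x) x := by
    intro x
    have e : A = fun x => A 0 + ∫ y in (0 : ℝ)..x, Real.exp (m * y) * h y := by
      ext x
      rw [← intervalIntegral.integral_Iic_sub_Iic (iA 0) (iA x)]
      ring
    rw [e]
    exact (Continuous.integral_hasStrictDerivAt (by fun_prop) 0 x).hasDerivAt.const_add _
  have dB : ∀ x, HasDerivAt B (-(Real.exp (-m * x) * h x)) x := by
    intro x
    have e : B = fun x => B 0 - ∫ y in (0 : ℝ)..x, Real.exp (-m * y) * h y := by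
      ext x
      rw [← intervalIntegral.integral_Ioi_sub_Ioi' (iB 0) (iB x)]
      ring
    rw [e]
    exact (Continuous.integral_hasStrictDerivAt (by fun_prop) 0 x).hasDerivAt.const_sub _
  have hexp : ∀ a x : ℝ, HasDerivAt (fun x => Real.exp (a * x)) (Real.exp (a * x) * a) x := by
    intro a x
    simpa using ((hasDerivAt_id x).const_mul a).exp
  have hinv : Real.exp (-m * x) * Real.exp (m * x) = 1 := by
    rw [← Real.exp_add]; simp
  constructor
  · rw [hsplit]
    refine ((((hexp (-m) x).mul (dA x)).add ((hexp m x).mul (dB x))).const_mul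
      (1 / (2 * m))).congr_deriv ?_
    change _ = 1 / 2 * (Real.exp (m * x) * B x - Real.exp (-m * x) * A x)
    field_simp
    ring
  · refine ((((hexp m x).mul (dB x)).sub ((hexp (-m) x).mul (dA x))).const_mul
      (1 / 2)).congr_deriv ?_
    rw [hsplit]
    field_simp
    rw [neg_mul] at hinv
    linear_combination (-2 * h x) * hinv

/-- The resolvent `(m² - ∂²)⁻¹` as a bounded operator on bounded continuous functions. -/
def resolvent (m : ℝ) (hm : 0 < m) : (ℝ →ᵇ ℝ) →L[ℝ] (ℝ →ᵇ ℝ) :=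
  LinearMap.mkContinuous
    { toFun := fun h => BoundedContinuousFunction.ofNormedAddCommGroup (resolventFun m h)
        (continuous_iff_continuousAt.2 fun x =>
          (hasDerivAt_resolventFun hm h.continuous h.norm_coe_le_norm x).1.continuousAt)
        (‖h‖ / m ^ 2) fun x => abs_resolventFun_le_norm hm h x
      map_add' := fun h k => by
        ext x
        exact resolventFun_add hm h.continuous k.continuous h.norm_coe_le_norm
          k.norm_coe_le_norm x
      map_smul' := fun c h => by
        ext x
        exact resolventFun_smul h c x }
    (1 / m ^ 2) fun h => by
      rw [one_div_mul_eq_div]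
      exact (BoundedContinuousFunction.norm_le (by positivity)).2
        (abs_resolventFun_le_norm hm h)

theorem hasDerivAt_resolvent {m : ℝ} (hm : 0 < m) (h : ℝ →ᵇ ℝ) (x : ℝ) :
    HasDerivAt (resolvent m hm h) (resolventFun' m h x) x :=
  (hasDerivAt_resolventFun hm h.continuous h.norm_coe_le_norm x).1

theorem hasDerivAt_deriv_resolvent {m : ℝ} (hm : 0 < m) (h : ℝ →ᵇ ℝ) (x : ℝ) :
    HasDerivAt (resolventFun' m h) (m ^ 2 * resolvent m hm h x - h x) x :=
  (hasDerivAt_resolventFun hm h.continuous h.norm_coe_le_norm x).2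

theorem abs_resolventFun'_le {m : ℝ} (hm : 0 < m) (h : ℝ →ᵇ ℝ) (x : ℝ) :
    |resolventFun' m h x| ≤ 3 * (‖resolvent m hm‖ + m ^ 2 * ‖resolvent m hm‖ + 1) * ‖h‖ := by
  have hu : ∀ y, |resolvent m hm h y| ≤ ‖resolvent m hm‖ * ‖h‖ := fun y =>
    ((resolvent m hm h).norm_coe_le_norm y).trans ((resolvent m hm).le_opNorm h)
  have hh : ∀ y, |h y| ≤ ‖h‖ := h.norm_coe_le_norm
  rw [mul_assoc]
  refine abs_deriv_le_of_abs_le (hasDerivAt_resolvent hm h) (hasDerivAt_deriv_resolvent hm h)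
    (fun y _ => (hu y).trans ?_) fun y _ => ?_
  · have : 0 ≤ (m ^ 2 * ‖resolvent m hm‖ + 1) * ‖h‖ := by positivity
    linarith
  · refine (abs_sub _ _).trans ?_
    rw [abs_mul, abs_of_nonneg (sq_nonneg m)]
    have := mul_le_mul_of_nonneg_left (hu y) (sq_nonneg m)
    have h3 : 0 ≤ ‖resolvent m hm‖ * ‖h‖ := by positivity
    linarith [hh y]

/-- Composition with the absolute value, which turns every function into an even one. -/
def evenize : (ℝ →ᵇ ℝ) →L[ℝ] (ℝ →ᵇ ℝ) :=
  LinearMap.mkContinuous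
    { toFun := fun h => h.compContinuous ⟨fun x => |x|, continuous_abs⟩
      map_add' := fun _ _ => rfl
      map_smul' := fun _ _ => rfl } 1 fun h => by
    rw [one_mul]
    exact (BoundedContinuousFunction.norm_le (norm_nonneg _)).2 fun x => h.norm_coe_le_norm _

@[simp] theorem evenize_apply (h : ℝ →ᵇ ℝ) (x : ℝ) : evenize h x = h |x| := rfl

theorem evenize_apply_of_even {h : ℝ →ᵇ ℝ} (he : ∀ x, h (-x) = h x) (x : ℝ) :
    evenize h x = h x := by
  rcases abs_cases x with ⟨e, -⟩ | ⟨e, -⟩ <;> simp [e, he]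

theorem resolvent_evenize_even {m : ℝ} (hm : 0 < m) (h : ℝ →ᵇ ℝ) (x : ℝ) :
    resolvent m hm (evenize h) (-x) = resolvent m hm (evenize h) x :=
  resolventFun_neg_of_even (by simp) x

/-- The derivative of an even function vanishes at zero. -/
theorem deriv_zero_of_even {φ φ' : ℝ → ℝ} (h1 : ∀ x, HasDerivAt φ (φ' x) x)
    (he : ∀ x, φ (-x) = φ x) : φ' 0 = 0 := by
  have h2 : HasDerivAt φ (-φ' 0) 0 := by
    have : HasDerivAt (fun x => φ (-x)) (φ' (-0) * -1) 0 :=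
      (h1 (-0)).comp (0 : ℝ) (hasDerivAt_neg (0 : ℝ))
    simpa [he] using this
  linarith [(h1 0).unique h2]

/-- A bounded solution of `m² u - u'' = h` with even `h` is given by the resolvent. -/
theorem resolvent_evenize_eq {m : ℝ} (hm : 0 < m) {u h : ℝ →ᵇ ℝ} {u' : ℝ → ℝ}
    (h1 : ∀ x, HasDerivAt u (u' x) x) (h2 : ∀ x, HasDerivAt u' (m ^ 2 * u x - h x) x)
    (he : ∀ x, h (-x) = h x) : resolvent m hm (evenize h) = u := by
  have e : evenize h = h := by ext x; exact evenize_apply_of_even he x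
  rw [e, ← sub_eq_zero]
  ext x
  refine eq_zero_of_bounded_of_deriv2_eq hm (u := (resolvent m hm h - u : ℝ →ᵇ ℝ))
    (fun x => (hasDerivAt_resolvent hm h x).sub (h1 x)) (fun x =>
    ((hasDerivAt_deriv_resolvent hm h x).sub (h2 x)).congr_deriv ?_)
    (resolvent m hm h - u).norm_coe_le_norm x
  simp
  ring

/-! ### Compactness -/

/-- An operator on bounded continuous functions on the line is compact if its values are
equi-Lipschitz and decay uniformly at infinity. -/
theorem isCompactOperator_of_lipschitz_of_decay (T : (ℝ →ᵇ ℝ) →L[ℝ] (ℝ →ᵇ ℝ)) {L : ℝ}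
    {h : ℝ → ℝ} (hL : ∀ φ x y, |T φ x - T φ y| ≤ L * ‖φ‖ * |x - y|)
    (hh : Tendsto h (cocompact ℝ) (𝓝 0)) (hT : ∀ φ x, |T φ x| ≤ h x * ‖φ‖) :
    IsCompactOperator T := by
  have hL0 : 0 ≤ L := by
    have := hL 1 0 1
    simp only [norm_one, mul_one, zero_sub, abs_neg, abs_one] at this
    exact (abs_nonneg _).trans this
  refine (isCompactOperator_iff_isCompact_closure_image_closedBall
    (T : (ℝ →ᵇ ℝ) →ₗ[ℝ] (ℝ →ᵇ ℝ)) one_pos).2 ?_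
  set A : Set (ℝ →ᵇ ℝ) := T '' Metric.closedBall 0 1 with hA
  suffices h : TotallyBounded A from h.closure.isCompact_of_isClosed isClosed_closure
  rw [Metric.totallyBounded_iff]
  intro ε hε
  obtain ⟨R, hR⟩ : ∃ R : ℝ, ∀ x, R < |x| → |h x| < ε / 3 := by
    have := (tendsto_order.1 hh.abs).2 (ε / 3) (by simpa using hε)
    rw [← Metric.cobounded_eq_cocompact, ← comap_norm_atTop (E := ℝ), eventually_comap] at this
    obtain ⟨R, hR⟩ := eventually_atTop.1 this
    exact ⟨R, fun x hx => hR |x| hx.le x rfl⟩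
  set r : (ℝ →ᵇ ℝ) → (Set.Icc (-R) R →ᵇ ℝ) := fun f => f.domRestrict (Set.Icc (-R) R) with hr
  have hB : TotallyBounded (r '' A) := by
    refine (BoundedContinuousFunction.arzela_ascoli (Metric.closedBall (0 : ℝ) ‖T‖)
      (isCompact_closedBall _ _) (r '' A) ?_ ?_).totallyBounded.subset subset_closure
    · rintro _ x ⟨_, ⟨φ, hφ, rfl⟩, rfl⟩
      rw [mem_closedBall_zero_iff] at hφ ⊢
      exact ((T φ).norm_coe_le_norm _).trans ((T.le_opNorm φ).trans
        (mul_le_of_le_one_right (norm_nonneg _) hφ))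
    · refine (LipschitzWith.uniformEquicontinuous _ ⟨L, hL0⟩ ?_).equicontinuous
      rintro ⟨_, _, ⟨φ, hφ, rfl⟩, rfl⟩
      rw [mem_closedBall_zero_iff] at hφ
      refine LipschitzWith.of_dist_le_mul fun x y => ?_
      refine (hL φ x y).trans ?_
      change L * ‖φ‖ * |(x : ℝ) - y| ≤ L * |(x : ℝ) - y|
      refine mul_le_mul_of_nonneg_right (mul_le_of_le_one_right hL0 hφ) (abs_nonneg _)
  obtain ⟨t, htB, htf, htc⟩ := totallyBounded_iff_subset.1 hB _
    (Metric.dist_mem_uniformity (half_pos hε))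
  have htB' : ∀ b ∈ t, ∃ f ∈ A, r f = b := htB
  choose! g hgA hgr using htB'
  refine ⟨g '' t, htf.image g, fun f hf => ?_⟩
  obtain ⟨b, hb, hfb⟩ := Set.mem_iUnion₂.1 (htc (Set.mem_image_of_mem r hf))
  refine Set.mem_iUnion₂.2 ⟨g b, Set.mem_image_of_mem g hb, ?_⟩
  have hsmall : ∀ f ∈ A, ∀ x, R < |x| → |f x| ≤ ε / 3 := by
    rintro _ ⟨φ, hφ, rfl⟩ x hx
    rw [mem_closedBall_zero_iff] at hφ
    have h1 := hT φ x
    have h2 := hR x hx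
    have h3 := le_abs_self (h x)
    nlinarith [norm_nonneg φ, abs_nonneg (h x)]
  refine ((BoundedContinuousFunction.dist_le (by positivity : 0 ≤ 2 * ε / 3)).2
    fun x => ?_).trans_lt (by linarith)
  by_cases hx : R < |x|
  · have h1 := abs_le.1 (hsmall f hf x hx)
    have h2 := abs_le.1 (hsmall (g b) (hgA b hb) x hx)
    rw [Real.dist_eq, abs_le]
    constructor <;> linarith
  · have hx' : x ∈ Set.Icc (-R) R := abs_le.1 (not_lt.1 hx)
    have h1 : dist (r f) b < ε / 2 := hfb
    have h2 := BoundedContinuousFunction.dist_coe_le_dist (f := r f) (g := b) ⟨x, hx'⟩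
    have h3 : b ⟨x, hx'⟩ = g b x := by
      conv_lhs => rw [← hgr b hb]
      rfl
    rw [h3] at h2
    exact (h2.trans h1.le).trans (by linarith)

/-- Multiplication by a function vanishing at infinity, followed by the resolvent, is compact. -/
theorem isCompactOperator_resolvent_mul {m : ℝ} (hm : 0 < m) (V : ℝ →ᵇ ℝ)
    (hV : Tendsto V (cocompact ℝ) (𝓝 0)) :
    IsCompactOperator ((resolvent m hm ∘L evenize) ∘L
      (ContinuousLinearMap.mul ℝ (ℝ →ᵇ ℝ) V)) := by
  set N : ℝ := 3 * (‖resolvent m hm‖ + m ^ 2 * ‖resolvent m hm‖ + 1) with hN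
  have hN0 : 0 ≤ N := by positivity
  have habs : Tendsto (fun x : ℝ => |x|) (cocompact ℝ) (cocompact ℝ) :=
    (tendsto_norm_cocompact_atTop (E := ℝ)).mono_right atTop_le_cocompact
  have hb : ∀ φ : ℝ →ᵇ ℝ, ‖evenize (V * φ)‖ ≤ ‖V‖ * ‖φ‖ := fun φ =>
    (BoundedContinuousFunction.norm_le (by positivity)).2 fun x =>
      ((V * φ).norm_coe_le_norm _).trans (norm_mul_le _ _)
  refine isCompactOperator_of_lipschitz_of_decay _ (L := N * ‖V‖)
    (h := resolventFun m fun x => |V (|x|)|) (fun φ x y => ?_)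
    (tendsto_resolventFun hm (by fun_prop) (C := ‖V‖) (fun x => ?_) ?_) fun φ x => ?_
  · have := Convex.norm_image_sub_le_of_norm_hasDerivWithin_le (s := Set.univ)
      (fun x _ => (hasDerivAt_resolvent hm (evenize (V * φ)) x).hasDerivWithinAt)
      (fun x _ => (abs_resolventFun'_le hm (evenize (V * φ)) x).trans
        (mul_le_mul_of_nonneg_left (hb φ) hN0)) convex_univ (Set.mem_univ y) (Set.mem_univ x)
    rw [mul_assoc N]
    exact this
  · rw [abs_abs]
    exact V.norm_coe_le_norm _
  · simpa using (hV.comp habs).abs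
  · refine (abs_resolventFun_le hm (evenize (V * φ)).continuous
      (k := fun x => ‖φ‖ * |V (|x|)|) (by fun_prop) (C := ‖φ‖ * ‖V‖) (fun x => ?_)
      (fun x => ?_) x).trans_eq ?_
    · rw [abs_mul, abs_norm, abs_abs]
      exact mul_le_mul_of_nonneg_left (V.norm_coe_le_norm _) (norm_nonneg _)
    · rw [evenize_apply, BoundedContinuousFunction.mul_apply, abs_mul, mul_comm]
      exact mul_le_mul_of_nonneg_right (φ.norm_coe_le_norm _) (abs_nonneg _)
    · rw [resolventFun_smul, mul_comm]

/-- Fredholm alternative: if `K` is compact and `1 - K` injective, then `1 - K` is onto. -/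
theorem surjective_sub_of_isCompactOperator {X : Type*} [NormedAddCommGroup X] [NormedSpace ℝ X]
    [CompleteSpace X] {K : X →L[ℝ] X} (hK : IsCompactOperator K)
    (hinj : ∀ φ, K φ = φ → φ = 0) (g : X) : ∃ φ, φ - K φ = g := by
  rcases hK.hasEigenvalue_or_mem_resolventSet (one_ne_zero (α := ℝ)) with h | h
  · obtain ⟨φ, hφ⟩ := h.exists_hasEigenvector
    exact absurd (hinj φ (by simpa using hφ.apply_eq_smul)) hφ.2
  · rw [spectrum.mem_resolventSet_iff, ContinuousLinearMap.isUnit_iff_bijective] at h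
    obtain ⟨φ, hφ⟩ := h.2 g
    exact ⟨φ, by simpa using hφ⟩

/-! ### Explicit homoclinic profiles -/

/-- The middle root of `ζ t - t³ + f` lies in the interval where the cubic is increasing. -/
theorem exists_middle_root {ζ f : ℝ} (hζ : 0 < ζ)
    (hf : |f| < 2 * Real.sqrt 3 / 9 * ζ ^ (3 / 2 : ℝ)) :
    ∃ w₀ : ℝ, 0 < ζ - 3 * w₀ ^ 2 ∧ ζ * w₀ - w₀ ^ 3 + f = 0 := by
  set t := Real.sqrt (ζ / 3) with ht
  have ht2 : t ^ 2 = ζ / 3 := Real.sq_sqrt (by positivity)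
  have ht0 : 0 < t := Real.sqrt_pos.2 (by positivity)
  have e : 2 * Real.sqrt 3 / 9 * ζ ^ (3 / 2 : ℝ) = 2 * t ^ 3 := by
    have h1 : ζ ^ (3 / 2 : ℝ) = ζ * Real.sqrt ζ := by
      rw [Real.sqrt_eq_rpow, ← Real.rpow_one_add' hζ.le (by norm_num)]; norm_num
    have h2 : t = Real.sqrt ζ / Real.sqrt 3 := Real.sqrt_div hζ.le 3
    have h3 : Real.sqrt 3 ^ 2 = 3 := Real.sq_sqrt (by norm_num)
    have h5 : Real.sqrt 3 ≠ 0 := by positivity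
    rw [h1, pow_succ, ht2, h2]
    field_simp
    rw [h3]; ring
  rw [e] at hf
  obtain ⟨hf1, hf2⟩ := abs_lt.1 hf
  have hcont : ContinuousOn (fun x : ℝ => ζ * x - x ^ 3 + f) (Set.Icc (-t) t) := by fun_prop
  have hζt : ζ = 3 * t ^ 2 := by linarith
  obtain ⟨w, hw, hw0⟩ := intermediate_value_Ioo (by linarith) hcont
    (show (0 : ℝ) ∈ Set.Ioo _ _ from ⟨by rw [hζt]; linarith [pow_succ t 2], by
      rw [hζt]; linarith [pow_succ t 2]⟩)
  refine ⟨w, ?_, hw0⟩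
  nlinarith [hw.1, hw.2]

/-- The two profiles homoclinic to `w₀`, distinguished by the sign `s = ±1`. With `c = ζ - 3 w₀²`
they are `w₀ + (B + A cosh(m x))⁻¹`, where `m² = c / d`, `B = w₀ / c` and `A² = B² + 1 / (2 c)`. -/
def profile (d ζ w₀ s x : ℝ) : ℝ :=
  w₀ + (w₀ / (ζ - 3 * w₀ ^ 2) + s * Real.sqrt (w₀ ^ 2 / (ζ - 3 * w₀ ^ 2) ^ 2 +
    1 / (2 * (ζ - 3 * w₀ ^ 2))) * Real.cosh (Real.sqrt ((ζ - 3 * w₀ ^ 2) / d) * x))⁻¹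

/-- The profile lies above `w₀` for `s = 1` and below it for `s = -1`; hence on the positive
half-line it is decreasing or increasing, respectively, which accounts for the sign `-s`. -/
theorem exists_isHomoclinicProfile {d ζ f w₀ s : ℝ} (hd : 0 < d) (hc : 0 < ζ - 3 * w₀ ^ 2)
    (h0 : ζ * w₀ - w₀ ^ 3 + f = 0) (hs : s = 1 ∨ s = -1) :
    (∃ w', IsHomoclinicProfile d ζ f w₀ (-s) (profile d ζ w₀ s) w') ∧
      (∀ x, 0 < s * (profile d ζ w₀ s x - w₀)) := by
  set c := ζ - 3 * w₀ ^ 2 with hcdef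
  set m := Real.sqrt (c / d) with hm
  set B := w₀ / c with hB
  set A₀ := Real.sqrt (w₀ ^ 2 / c ^ 2 + 1 / (2 * c)) with hA₀
  set A := s * A₀ with hA
  have hm2 : m ^ 2 = c / d := Real.sq_sqrt (by positivity)
  have hm0 : 0 < m := Real.sqrt_pos.2 (by positivity)
  have hs2 : s ^ 2 = 1 := by rcases hs with rfl | rfl <;> norm_num
  have hA₀2 : A₀ ^ 2 = B ^ 2 + 1 / (2 * c) := by
    rw [hA₀, Real.sq_sqrt (by positivity), hB, div_pow]
  have hA2 : A ^ 2 = B ^ 2 + 1 / (2 * c) := by rw [hA, mul_pow, hs2, one_mul, hA₀2]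
  have hA₀0 : 0 < A₀ := Real.sqrt_pos.2 (by positivity)
  have hAB : |B| < A₀ := by
    refine abs_lt_of_sq_lt_sq ?_ hA₀0.le
    rw [hA₀2]
    have : 0 < 1 / (2 * c) := by positivity
    linarith
  have hcB : c * B = w₀ := by rw [hB]; field_simp
  set z : ℝ → ℝ := fun x => B + A * Real.cosh (m * x) with hz
  have hw : profile d ζ w₀ s = fun x => w₀ + (z x)⁻¹ := rfl
  -- `s z` is bounded below
  have hsz : ∀ x, A₀ * Real.cosh (m * x) - |B| ≤ s * z x := by
    intro x
    have e : s * z x = s * B + s ^ 2 * (A₀ * Real.cosh (m * x)) := by simp only [hz, hA]; ring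
    rw [e, hs2, one_mul]
    have : -|B| ≤ s * B := by
      rcases hs with rfl | rfl
      · linarith [neg_abs_le B]
      · linarith [le_abs_self B]
    linarith
  have hsz1 : ∀ x, A₀ - |B| ≤ s * z x := fun x => by
    have := hsz x
    have := Real.one_le_cosh (m * x)
    nlinarith
  have hszpos : ∀ x, 0 < s * z x := fun x => by linarith [hsz1 x]
  have hz0 : ∀ x, z x ≠ 0 := fun x h => by simpa [h] using hszpos x
  have hsinv : ∀ x, s * (z x)⁻¹ = (s * z x)⁻¹ := fun x => by
    rcases hs with rfl | rfl <;> simp [inv_neg]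
  have dcosh : ∀ x, HasDerivAt z (A * (Real.sinh (m * x) * m)) x := by
    intro x
    exact ((((hasDerivAt_id x).const_mul m).cosh.const_mul A).const_add B).congr_deriv (by simp)
  have dsinh : ∀ x, HasDerivAt (fun x => A * (Real.sinh (m * x) * m))
      (A * (Real.cosh (m * x) * m * m)) x := by
    intro x
    simpa using ((((hasDerivAt_id x).const_mul m).sinh.mul_const m).const_mul A)
  have habs : ∀ x, |(z x)⁻¹| = (s * z x)⁻¹ := fun x => by
    rw [← hsinv, ← abs_of_pos (a := s * (z x)⁻¹) (by rw [hsinv]; exact inv_pos.2 (hszpos x)),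
      abs_mul]
    rcases hs with rfl | rfl <;> simp
  refine ⟨⟨fun x => -(A * (Real.sinh (m * x) * m)) / z x ^ 2, ?_⟩, fun x => ?_⟩
  · constructor
    · intro x
      rw [hw]
      exact ((dcosh x).inv (hz0 x)).const_add w₀
    · intro x
      refine ((dsinh x).neg.div ((dcosh x).pow 2) (pow_ne_zero 2 (hz0 x))).congr_deriv ?_
      simp only [hw, Pi.pow_apply, Pi.neg_apply]
      have hzx := hz0 x
      -- `z` satisfies `z'' = m² (z - B)` and the first integral `z'² = m² ((z - B)² - A²)`
      have hcosh : A * Real.cosh (m * x) = z x - B := by simp [hz]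
      have hsinh : A ^ 2 * Real.sinh (m * x) ^ 2 = (z x - B) ^ 2 - A ^ 2 := by
        rw [← hcosh, Real.sinh_sq]; ring
      have hfe : f = w₀ ^ 3 - ζ * w₀ := by linarith
      have hζe : ζ = c + 3 * w₀ ^ 2 := by rw [hcdef]; ring
      have e1 : c * A ^ 2 = w₀ * B + 1 / 2 := by
        rw [hA2]; field_simp; linear_combination (2 * B) * hcB
      have hdm : d * m ^ 2 = c := by rw [hm2]; field_simp
      rw [eq_div_iff hd.ne', hfe, hζe]
      field_simp
      generalize z x = Z at *
      generalize Real.cosh (m * x) = C at *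
      generalize Real.sinh (m * x) = S at *
      push_cast
      linear_combination (-A * C * Z ^ 2 + 2 * A ^ 2 * S ^ 2 * Z) * hdm - c * Z ^ 2 * hcosh +
        2 * c * Z * hsinh - 2 * Z * e1 + (-3 * Z ^ 2 + 2 * B * Z) * hcB
    · intro x
      simp [hw, hz, Real.cosh_neg]
    · simp
    · have hz00 := hz0 0
      intro h
      have hZ : z 0 = A + B := by simp [hz, add_comm]
      have hAne : A ≠ 0 := by
        rw [hA]; rcases hs with rfl | rfl <;> simp [hA₀0.ne']
      have hfe : f = w₀ ^ 3 - ζ * w₀ := by linarith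
      have hζe : ζ = c + 3 * w₀ ^ 2 := by rw [hcdef]; ring
      have e1 : c * A ^ 2 = w₀ * B + 1 / 2 := by
        rw [hA2]; field_simp; linear_combination (2 * B) * hcB
      rw [hw, hfe, hζe] at h
      have h3 : c * z 0 ^ 2 - 3 * w₀ * z 0 - 1 = 0 := by
        field_simp at h
        linear_combination h
      -- as `z(0) = A + B`, the relation `h3` for `w''(0) = 0` reads `c A (A + B) = 0`
      have h4 : c * A * z 0 = 0 := by
        rw [hZ] at h3 ⊢
        linear_combination -h3 + 2 * e1 + (3 * A + B) * hcB
      exact mul_ne_zero (mul_ne_zero hc.ne' hAne) hz00 h4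
    · intro x hx
      have : 0 < Real.sinh (m * x) := Real.sinh_pos_iff.2 (by positivity)
      have e : -s * (-(A * (Real.sinh (m * x) * m)) / z x ^ 2)
          = s ^ 2 * (A₀ * (Real.sinh (m * x) * m)) / z x ^ 2 := by rw [hA]; ring
      rw [e, hs2]
      have := hz0 x
      positivity
    · refine ⟨|w₀| + (A₀ - |B|)⁻¹, fun x => ?_⟩
      rw [hw]
      refine (abs_add_le _ _).trans (add_le_add le_rfl ?_)
      rw [habs]
      exact inv_anti₀ (by linarith) (hsz1 x)
    · rw [hw]
      have hcosh : Tendsto Real.cosh atTop atTop :=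
        tendsto_atTop_mono (fun x => by
          rw [Real.cosh_eq]; linarith [Real.exp_pos (-x)] : ∀ x, Real.exp x / 2 ≤ Real.cosh x)
          (Real.tendsto_exp_atTop.atTop_div_const two_pos)
      have ht : Tendsto (fun x => A₀ * Real.cosh (m * x) - |B|) atTop atTop :=
        tendsto_atTop_add_const_right _ _ ((hcosh.comp
          (tendsto_id.const_mul_atTop hm0)).const_mul_atTop hA₀0)
      have h2 := (tendsto_atTop_mono hsz ht).inv_tendsto_atTop
      have h3 : Tendsto (fun x => (z x)⁻¹) atTop (𝓝 0) := by
        rw [tendsto_zero_iff_abs_tendsto_zero]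
        exact h2.congr fun x => (habs x).symm
      simpa using h3.const_add w₀
    · exact h0
  · rw [hw, add_sub_cancel_left, hsinv]
    exact inv_pos.2 (hszpos x)

/-! ### The perturbed system near the profile -/

/-- The right-hand side of the system `d p'' = …`, `d q'' = …` satisfied by the real and imaginary
parts of `w = p + i q`, where `d w'' = (ζ - i ε) w - (1 + i κ) |w|² w + f`. The unknowns live in a
real Banach algebra, which is `ℝ` for equilibria and `ℝ →ᵇ ℝ` for profiles; the argument is
`((p, q), (ε, κ))`. -/
def cubicField {A : Type*} [NormedCommRing A] [NormedAlgebra ℝ A] (ζ f : ℝ)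
    (x : (A × A) × (ℝ × ℝ)) : A × A :=
  (ζ • x.1.1 + x.2.1 • x.1.2
      - (x.1.1 * x.1.1 + x.1.2 * x.1.2) * (x.1.1 - x.2.2 • x.1.2) + f • (1 : A),
    ζ • x.1.2 - x.2.1 • x.1.1
      - (x.1.1 * x.1.1 + x.1.2 * x.1.2) * (x.1.2 + x.2.2 • x.1.1))

/-- At a real state with `ε = κ = 0` the derivative is diagonal in the unknowns. -/
theorem exists_hasStrictFDerivAt_cubicField {A : Type*} [NormedCommRing A] [NormedAlgebra ℝ A]
    (ζ f : ℝ) (W : A) :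
    ∃ D : (A × A) × (ℝ × ℝ) →L[ℝ] A × A,
      HasStrictFDerivAt (cubicField ζ f) D ((W, 0), 0) ∧
        ∀ φ ψ, D ((φ, ψ), 0) = (ζ • φ - 3 * W * W * φ, ζ • ψ - W * W * ψ) := by
  have hsm : ContDiff ℝ 1 (cubicField (A := A) ζ f) := by
    unfold cubicField
    fun_prop
  refine ⟨_, hsm.contDiffAt.hasStrictFDerivAt one_ne_zero, fun φ ψ => ?_⟩
  have hline : HasDerivAt (fun t : ℝ => (((W, 0), 0) + t • ((φ, ψ), 0) : (A × A) × (ℝ × ℝ)))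
      ((φ, ψ), 0) 0 := by
    simpa using ((hasDerivAt_id (0 : ℝ)).smul_const (((φ, ψ), 0) : (A × A) × (ℝ × ℝ))).const_add
      (((W, 0), 0) : (A × A) × (ℝ × ℝ))
  have hpt : (((W, 0), 0) : (A × A) × (ℝ × ℝ)) = ((W, 0), 0) + (0 : ℝ) • ((φ, ψ), 0) := by simp
  have h1 := HasFDerivAt.comp_hasDerivAt_of_eq (0 : ℝ)
    (hsm.contDiffAt.hasStrictFDerivAt one_ne_zero).hasFDerivAt hline hpt
  have ha : HasDerivAt (fun t : ℝ => W + t • φ) φ 0 := by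
    simpa using ((hasDerivAt_id (0 : ℝ)).smul_const φ).const_add W
  have hb : HasDerivAt (fun t : ℝ => t • ψ) ψ 0 := by
    simpa using (hasDerivAt_id (0 : ℝ)).smul_const ψ
  have hab := (ha.mul ha).add (hb.mul hb)
  have h2 := (((ha.const_smul ζ).sub (hab.mul ha)).add_const (f • (1 : A))).prodMk
    ((hb.const_smul ζ).sub (hab.mul hb))
  refine (h1.unique (h2.congr_of_eventuallyEq (Eventually.of_forall fun t => ?_))).trans ?_
  · simp [cubicField]
  · simp
    ring

/-- Existence part of the implicit function theorem with surjective partial derivative. -/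
theorem exists_zero_of_surjective {E : Type*} [NormedAddCommGroup E] [NormedSpace ℝ E]
    [CompleteSpace E] {F : E × (ℝ × ℝ) → E} {x₀ : E} {D : E × (ℝ × ℝ) →L[ℝ] E}
    (hD : HasStrictFDerivAt F D (x₀, 0)) (h0 : F (x₀, 0) = 0)
    (hsurj : ∀ y, ∃ x, D (x, 0) = y) {r : ℝ} (hr : 0 < r) :
    ∃ δ > 0, ∀ ε κ : ℝ, |ε| < δ → |κ| < δ → ∃ x, ‖x - x₀‖ < r ∧ F (x, (ε, κ)) = 0 := by
  have hΦ : HasStrictFDerivAt (fun z : E × (ℝ × ℝ) => (F z, z.2))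
      (D.prod (ContinuousLinearMap.snd ℝ E (ℝ × ℝ))) (x₀, 0) := hD.prodMk hasStrictFDerivAt_snd
  have hmap := hΦ.map_nhds_eq_of_surj (by
    rw [LinearMap.range_eq_top]
    rintro ⟨y, π⟩
    obtain ⟨x, hx⟩ := hsurj (y - D (0, π))
    refine ⟨(x, π), ?_⟩
    have : D (x, π) = D (x, 0) + D (0, π) := by rw [← map_add]; simp
    simp [this, hx])
  have hmem : (fun z : E × (ℝ × ℝ) => (F z, z.2)) '' Metric.ball (x₀, 0) r ∈
      𝓝 ((0 : E), ((0 : ℝ × ℝ))) := by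
    have := image_mem_map (m := fun z : E × (ℝ × ℝ) => (F z, z.2))
      (Metric.ball_mem_nhds ((x₀, 0) : E × (ℝ × ℝ)) hr)
    rw [hmap] at this
    simpa [h0] using this
  obtain ⟨δ, hδ, hball⟩ := Metric.mem_nhds_iff.1 hmem
  refine ⟨δ, hδ, fun ε κ hε hκ => ?_⟩
  obtain ⟨⟨x, π⟩, hx, he⟩ := hball (show ((0 : E), (ε, κ)) ∈ Metric.ball _ δ by
    rw [Metric.mem_ball, dist_eq_norm]
    simp [Prod.norm_def, hε, hκ])
  simp only [Prod.mk.injEq] at he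
  obtain ⟨he1, rfl⟩ := he
  refine ⟨x, ?_, he1⟩
  rw [Metric.mem_ball, dist_eq_norm] at hx
  exact lt_of_le_of_lt (norm_fst_le ((x, (ε, κ)) - (x₀, 0))) hx

/-- Equilibria of the perturbed system near `w₀`. -/
theorem exists_equilibrium {ζ f w₀ : ℝ} (hc : 0 < ζ - 3 * w₀ ^ 2)
    (h0 : ζ * w₀ - w₀ ^ 3 + f = 0) {r : ℝ} (hr : 0 < r) :
    ∃ δ > 0, ∀ ε κ : ℝ, |ε| < δ → |κ| < δ →
      ∃ P Q : ℝ, |P - w₀| < r ∧ |Q| < r ∧ cubicField ζ f ((P, Q), (ε, κ)) = 0 := by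
  obtain ⟨D, hD, hDe⟩ := exists_hasStrictFDerivAt_cubicField ζ f w₀
  have hc' : 0 < ζ - w₀ ^ 2 := by nlinarith [sq_nonneg w₀]
  obtain ⟨δ, hδ, h⟩ := exists_zero_of_surjective hD
    (by simp [cubicField]; linarith) (fun y =>
      ⟨(y.1 / (ζ - 3 * w₀ ^ 2), y.2 / (ζ - w₀ ^ 2)), by
        rw [hDe]
        ext
        · simp only [smul_eq_mul]; field_simp
        · simp only [smul_eq_mul]; field_simp⟩) hr
  refine ⟨δ, hδ, fun ε κ hε hκ => ?_⟩
  obtain ⟨⟨P, Q⟩, hPQ, h⟩ := h ε κ hε hκ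
  exact ⟨P, Q, lt_of_le_of_lt (norm_fst_le ((P, Q) - (w₀, 0))) hPQ,
    by simpa using lt_of_le_of_lt (norm_snd_le ((P, Q) - (w₀, 0))) hPQ, h⟩

/-- Near the hyperbolic equilibrium the field is strongly monotone, as its derivative is close to
the diagonal matrix with entries `ζ - 3 w₀²` and `ζ - w₀²`. -/
theorem exists_cubicField_monotone {ζ f w₀ : ℝ} (hc : 0 < ζ - 3 * w₀ ^ 2) :
    ∃ ρ > 0, ∀ p q P Q ε κ : ℝ, |p - w₀| < ρ → |q| < ρ → |P - w₀| < ρ → |Q| < ρ →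
      |ε| < ρ → |κ| < ρ →
      (ζ - 3 * w₀ ^ 2) / 2 * ((p - P) ^ 2 + (q - Q) ^ 2) ≤
        (p - P) * ((cubicField ζ f ((p, q), (ε, κ))).1 - (cubicField ζ f ((P, Q), (ε, κ))).1) +
        (q - Q) * ((cubicField ζ f ((p, q), (ε, κ))).2 - (cubicField ζ f ((P, Q), (ε, κ))).2) := by
  set c := ζ - 3 * w₀ ^ 2 with hcdef
  obtain ⟨D, hD, hDe⟩ := exists_hasStrictFDerivAt_cubicField ζ f w₀
  have ho := (hasStrictFDerivAt_iff_isLittleO.1 hD).def (c := c / 4) (by positivity)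
  obtain ⟨ρ, hρ, hb⟩ := Metric.eventually_nhds_iff_ball.1 ho
  refine ⟨ρ, hρ, fun p q P Q ε κ h1 h2 h3 h4 h5 h6 => ?_⟩
  have hmem : ∀ p q : ℝ, |p - w₀| < ρ → |q| < ρ → dist ((p, q), (ε, κ)) ((w₀, 0), 0) < ρ := by
    intro p q h1 h2
    rw [dist_eq_norm]
    simp [Prod.norm_def, h1, h2, h5, h6]
  have key := hb (((p, q), (ε, κ)), ((P, Q), (ε, κ))) (by
    rw [Metric.mem_ball, Prod.dist_eq]
    exact max_lt (hmem p q h1 h2) (hmem P Q h3 h4))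
  have hsub : (((p, q), (ε, κ)) - ((P, Q), (ε, κ)) : (ℝ × ℝ) × (ℝ × ℝ))
      = ((p - P, q - Q), 0) := by simp
  simp only [hsub, hDe] at key
  generalize cubicField ζ f ((p, q), (ε, κ)) = N₁ at *
  generalize cubicField ζ f ((P, Q), (ε, κ)) = N₂ at *
  generalize hu : p - P = u at *
  generalize hv : q - Q = v at *
  have hn : ‖((u, v), (0 : ℝ × ℝ))‖ ≤ |u| + |v| := by
    simp [Prod.norm_def, abs_nonneg]
  have k1 := (norm_fst_le _).trans (key.trans (mul_le_mul_of_nonneg_left hn (by positivity)))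
  have k2 := (norm_snd_le _).trans (key.trans (mul_le_mul_of_nonneg_left hn (by positivity)))
  simp only [Prod.fst_sub, Prod.snd_sub, smul_eq_mul, Real.norm_eq_abs] at k1 k2
  have j1 : -(c / 4 * (|u| + |v|) * |u|) ≤
      u * (N₁.1 - N₂.1 - (ζ * u - 3 * w₀ * w₀ * u)) := by
    refine le_trans ?_ (neg_abs_le _)
    rw [abs_mul, mul_comm |u|]
    exact neg_le_neg (mul_le_mul_of_nonneg_right k1 (abs_nonneg _))
  have j2 : -(c / 4 * (|u| + |v|) * |v|) ≤
      v * (N₁.2 - N₂.2 - (ζ * v - w₀ * w₀ * v)) := by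
    refine le_trans ?_ (neg_abs_le _)
    rw [abs_mul, mul_comm |v|]
    exact neg_le_neg (mul_le_mul_of_nonneg_right k2 (abs_nonneg _))
  have hs : (|u| + |v|) * (|u| + |v|) ≤ 2 * (u ^ 2 + v ^ 2) := by
    nlinarith [sq_abs u, sq_abs v, sq_nonneg (|u| - |v|)]
  have hs' := mul_le_mul_of_nonneg_left hs (by positivity : 0 ≤ c / 4)
  have hv2 : 0 ≤ 2 * (w₀ * v) ^ 2 := by positivity
  have hζ : ζ = c + 3 * w₀ ^ 2 := by rw [hcdef]; ring
  rw [hζ] at j1 j2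
  nlinarith

/-- Persistence of the profile: for small parameters the perturbed system has an even solution
uniformly close to the unperturbed profile. -/
theorem exists_perturbed_profile {d ζ f w₀ s : ℝ} {w w' : ℝ → ℝ}
    (H : IsHomoclinicProfile d ζ f w₀ s w w') (hd : 0 < d) (hf : f ≠ 0)
    (hc : 0 < ζ - 3 * w₀ ^ 2) {r : ℝ} (hr : 0 < r) :
    ∃ δ > 0, ∀ ε κ : ℝ, |ε| < δ → |κ| < δ → ∃ p p' q q' : ℝ → ℝ,
      (∀ x, |p x - w x| < r) ∧ (∀ x, |q x| < r) ∧ (∀ x, p (-x) = p x) ∧ (∀ x, q (-x) = q x) ∧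
      (∀ x, HasDerivAt p (p' x) x) ∧ (∀ x, HasDerivAt q (q' x) x) ∧
      (∀ x, HasDerivAt p' ((cubicField ζ f ((p x, q x), (ε, κ))).1 / d) x) ∧
      (∀ x, HasDerivAt q' ((cubicField ζ f ((p x, q x), (ε, κ))).2 / d) x) := by
  have hc' : 0 < ζ - w₀ ^ 2 := by nlinarith [sq_nonneg w₀]
  have hw₀ : w₀ ≠ 0 := fun h => hf (by simpa [h] using H.equilibrium)
  set m₁ := Real.sqrt ((ζ - 3 * w₀ ^ 2) / d) with hm₁
  set m₂ := Real.sqrt ((ζ - w₀ ^ 2) / d) with hm₂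
  have h₁ : 0 < m₁ := Real.sqrt_pos.2 (by positivity)
  have h₂ : 0 < m₂ := Real.sqrt_pos.2 (by positivity)
  have s₁ : m₁ ^ 2 = (ζ - 3 * w₀ ^ 2) / d := Real.sq_sqrt (by positivity)
  have s₂ : m₂ ^ 2 = (ζ - w₀ ^ 2) / d := Real.sq_sqrt (by positivity)
  have hwc : Continuous w := continuous_iff_continuousAt.2 fun x => (H.hasDerivAt x).continuousAt
  obtain ⟨W, hW⟩ : ∃ W : ℝ →ᵇ ℝ, ∀ x, W x = w x := by
    obtain ⟨M, hM⟩ := H.bounded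
    exact ⟨BoundedContinuousFunction.ofNormedAddCommGroup w hwc M hM, fun x => rfl⟩
  set G₁ := resolvent m₁ h₁ ∘L evenize with hG₁
  set G₂ := resolvent m₂ h₂ ∘L evenize with hG₂
  -- a zero of `F` is a fixed point of `(G₁, G₂)` applied to `(m₁² p - N₁ / d, m₂² q - N₂ / d)`
  set T := G₁.prodMap G₂ with hT
  set M := (m₁ ^ 2 • ContinuousLinearMap.id ℝ (ℝ →ᵇ ℝ)).prodMap
    (m₂ ^ 2 • ContinuousLinearMap.id ℝ (ℝ →ᵇ ℝ)) with hM
  set F : ((ℝ →ᵇ ℝ) × (ℝ →ᵇ ℝ)) × (ℝ × ℝ) → (ℝ →ᵇ ℝ) × (ℝ →ᵇ ℝ) :=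
    fun x => x.1 - T (M x.1 - (1 / d) • cubicField ζ f x) with hF
  obtain ⟨D, hD, hDe⟩ := exists_hasStrictFDerivAt_cubicField ζ f W
  have hFD := hasStrictFDerivAt_fst.sub (T.hasStrictFDerivAt.comp ((W, 0), 0)
    ((M.hasStrictFDerivAt.comp ((W, 0), (0 : ℝ × ℝ)) hasStrictFDerivAt_fst).sub
      (hD.const_smul (1 / d))))
  have hF0 : F ((W, 0), 0) = 0 := by
    have e1 : G₁ (m₁ ^ 2 • W - (1 / d) • (cubicField ζ f ((W, 0), 0)).1) = W := by
      refine resolvent_evenize_eq h₁ (u' := w') (fun x => ?_) (fun x => ?_) fun x => ?_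
      · rw [show (W : ℝ → ℝ) = w from funext hW]
        exact H.hasDerivAt x
      · refine (H.hasDerivAt' x).congr_deriv ?_
        simp [cubicField, hW]
        ring
      · simp [cubicField, hW, H.even]
    have e2 : (cubicField ζ f ((W, 0), 0)).2 = 0 := by simp [cubicField]
    simp only [hF, hT, hM]
    ext1
    · simpa [sub_eq_zero] using e1.symm
    · simp [e2]
  -- the potentials of the two linearizations, relative to their values at infinity
  have hVlim : ∀ k : ℝ, Tendsto (fun x => k / d * (w x ^ 2 - w₀ ^ 2)) (cocompact ℝ) (𝓝 0) := by
    intro k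
    have ht : Tendsto (fun x => k / d * (w x ^ 2 - w₀ ^ 2)) atTop (𝓝 0) := by
      have := ((H.tendsto.pow 2).sub_const (w₀ ^ 2)).const_mul (k / d)
      rwa [sub_self, mul_zero] at this
    have hb : Tendsto (fun x => k / d * (w x ^ 2 - w₀ ^ 2)) atBot (𝓝 0) :=
      (ht.comp tendsto_neg_atBot_atTop).congr fun x => by simp [H.even]
    rw [cocompact_eq_atBot_atTop]
    exact hb.sup ht
  set V₁ : ℝ →ᵇ ℝ := (3 / d) • (W * W - w₀ ^ 2 • 1) with hV₁
  set V₂ : ℝ →ᵇ ℝ := (1 / d) • (W * W - w₀ ^ 2 • 1) with hV₂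
  have hV₁x : ∀ x, V₁ x = 3 / d * (w x ^ 2 - w₀ ^ 2) := fun x => by
    simp [hV₁, hW, sq]
  have hV₂x : ∀ x, V₂ x = 1 / d * (w x ^ 2 - w₀ ^ 2) := fun x => by
    simp [hV₂, hW, sq]
  have surj₁ : ∀ g, ∃ φ, φ - G₁ (V₁ * φ) = g := by
    refine surjective_sub_of_isCompactOperator (isCompactOperator_resolvent_mul h₁ V₁
      ((hVlim 3).congr fun x => (hV₁x x).symm)) fun φ hφ => ?_
    change resolvent m₁ h₁ (evenize (V₁ * φ)) = φ at hφ
    have heven : ∀ x, φ (-x) = φ x := fun x => by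
      rw [← hφ]; exact resolvent_evenize_even h₁ _ x
    have d1 := hasDerivAt_resolvent h₁ (evenize (V₁ * φ))
    have d2 := hasDerivAt_deriv_resolvent h₁ (evenize (V₁ * φ))
    rw [hφ] at d1 d2
    ext x
    refine H.real_kernel_eq_zero hd hc d1 (fun x => (d2 x).congr_deriv ?_) φ.norm_coe_le_norm
      heven (deriv_zero_of_even d1 heven) x
    rw [evenize_apply_of_even (fun x => by simp [hV₁x, H.even, heven])]
    simp only [BoundedContinuousFunction.mul_apply, hV₁x, s₁]
    ring
  have surj₂ : ∀ g, ∃ φ, φ - G₂ (V₂ * φ) = g := by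
    refine surjective_sub_of_isCompactOperator (isCompactOperator_resolvent_mul h₂ V₂
      ((hVlim 1).congr fun x => (hV₂x x).symm)) fun φ hφ => ?_
    change resolvent m₂ h₂ (evenize (V₂ * φ)) = φ at hφ
    have heven : ∀ x, φ (-x) = φ x := fun x => by
      rw [← hφ]; exact resolvent_evenize_even h₂ _ x
    have d1 := hasDerivAt_resolvent h₂ (evenize (V₂ * φ))
    have d2 := hasDerivAt_deriv_resolvent h₂ (evenize (V₂ * φ))
    rw [hφ] at d1 d2
    ext x
    refine H.imag_kernel_eq_zero hd hf hw₀ hc' d1 (fun x => (d2 x).congr_deriv ?_)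
      φ.norm_coe_le_norm (deriv_zero_of_even d1 heven) x
    rw [evenize_apply_of_even (fun x => by simp [hV₂x, H.even, heven])]
    simp only [BoundedContinuousFunction.mul_apply, hV₂x, s₂]
    ring
  obtain ⟨δ, hδ, hsol⟩ := exists_zero_of_surjective hFD hF0 (fun g => by
    obtain ⟨φ, hφ⟩ := surj₁ g.1
    obtain ⟨ψ, hψ⟩ := surj₂ g.2
    have e1 : m₁ ^ 2 • φ - (1 / d) • (ζ • φ - 3 * W * W * φ) = V₁ * φ := by
      ext x
      simp [hV₁x, hW, s₁]
      ring
    have e2 : m₂ ^ 2 • ψ - (1 / d) • (ζ • ψ - W * W * ψ) = V₂ * ψ := by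
      ext x
      simp [hV₂x, hW, s₂]
      ring
    refine ⟨(φ, ψ), ?_⟩
    have e3 : (M (φ, ψ) - (1 / d) • D ((φ, ψ), 0)) = (V₁ * φ, V₂ * ψ) := by
      rw [hDe, ← e1, ← e2]; rfl
    change (φ, ψ) - T (M (φ, ψ) - (1 / d) • D ((φ, ψ), 0)) = g
    rw [e3]
    exact Prod.ext hφ hψ) hr
  refine ⟨δ, hδ, fun ε κ hε hκ => ?_⟩
  obtain ⟨⟨p, q⟩, hpq, h0⟩ := hsol ε κ hε hκ
  set N := cubicField ζ f ((p, q), (ε, κ)) with hN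
  have hp : p = resolvent m₁ h₁ (evenize (m₁ ^ 2 • p - (1 / d) • N.1)) :=
    sub_eq_zero.1 (congrArg Prod.fst h0)
  have hq : q = resolvent m₂ h₂ (evenize (m₂ ^ 2 • q - (1 / d) • N.2)) :=
    sub_eq_zero.1 (congrArg Prod.snd h0)
  have hpe : ∀ x, p (-x) = p x := fun x => by rw [hp]; exact resolvent_evenize_even h₁ _ x
  have hqe : ∀ x, q (-x) = q x := fun x => by rw [hq]; exact resolvent_evenize_even h₂ _ x
  have dp1 := hasDerivAt_resolvent h₁ (evenize (m₁ ^ 2 • p - (1 / d) • N.1))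
  have dp2 := hasDerivAt_deriv_resolvent h₁ (evenize (m₁ ^ 2 • p - (1 / d) • N.1))
  have dq1 := hasDerivAt_resolvent h₂ (evenize (m₂ ^ 2 • q - (1 / d) • N.2))
  have dq2 := hasDerivAt_deriv_resolvent h₂ (evenize (m₂ ^ 2 • q - (1 / d) • N.2))
  rw [← hp] at dp1 dp2
  rw [← hq] at dq1 dq2
  have hN1 : ∀ x, N.1 x = (cubicField ζ f ((p x, q x), (ε, κ))).1 := fun x => by
    simp [hN, cubicField]
  have hN2 : ∀ x, N.2 x = (cubicField ζ f ((p x, q x), (ε, κ))).2 := fun x => by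
    simp [hN, cubicField]
  refine ⟨p, _, q, _, fun x => ?_, fun x => ?_, hpe, hqe, dp1, dq1,
    fun x => (dp2 x).congr_deriv ?_, fun x => (dq2 x).congr_deriv ?_⟩
  · have := (p - W).norm_coe_le_norm x
    rw [BoundedContinuousFunction.sub_apply, hW] at this
    exact this.trans_lt (lt_of_le_of_lt (norm_fst_le ((p, q) - (W, 0))) hpq)
  · refine (q.norm_coe_le_norm x).trans_lt ?_
    have := lt_of_le_of_lt (norm_snd_le ((p, q) - (W, 0))) hpq
    simpa using this
  · rw [evenize_apply_of_even (fun x => by simp [hN1, hpe, hqe])]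
    simp [hN1]
    ring
  · rw [evenize_apply_of_even (fun x => by simp [hN2, hpe, hqe])]
    simp [hN2]
    ring

/-! ### Exponential decay and Sobolev regularity -/

theorem integrable_of_exp_decay {E : Type*} [NormedAddCommGroup E] {u : ℝ → E} {C μ : ℝ}
    (hμ : 0 < μ) (hu : Continuous u) (h : ∀ x, ‖u x‖ ≤ C * Real.exp (-μ * |x|)) :
    Integrable u :=
  ((integrable_exp_neg_mul_abs hμ).const_mul C).mono' hu.aestronglyMeasurable
    (Eventually.of_forall h)

theorem memLp_two_of_exp_decay {u : ℝ → ℂ} {C μ : ℝ} (hμ : 0 < μ) (hu : Continuous u)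
    (h : ∀ x, ‖u x‖ ≤ C * Real.exp (-μ * |x|)) : MemLp u 2 := by
  refine (memLp_two_iff_integrable_sq_norm hu.aestronglyMeasurable).2
    (integrable_of_exp_decay (C := C ^ 2) (mul_pos two_pos hμ) (by fun_prop) fun x => ?_)
  have e : C ^ 2 * Real.exp (-(2 * μ) * |x|) = (C * Real.exp (-μ * |x|)) ^ 2 := by
    rw [mul_pow, ← Real.exp_nat_mul]; push_cast; ring_nf
  rw [e, norm_pow, norm_norm]
  exact pow_le_pow_left₀ (norm_nonneg _) (h x) 2

/-- A classical derivative is a weak derivative. -/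
theorem isWeakDeriv_of_hasDerivAt {u u' : ℝ → ℂ} (h : ∀ x, HasDerivAt u (u' x) x)
    (hc : Continuous u') : IsWeakDeriv u u' := by
  have hu : Continuous u := continuous_iff_continuousAt.2 fun x => (h x).continuousAt
  refine ⟨hu.locallyIntegrable, hc.locallyIntegrable, fun φ hφ hs => ?_⟩
  have hφ' : Continuous (deriv φ) := hφ.continuous_deriv (by simp)
  have i1 : Integrable fun x => deriv φ x • u x :=
    (hφ'.smul hu).integrable_of_hasCompactSupport hs.deriv.smul_right
  have i2 : Integrable fun x => φ x • u' x :=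
    (hφ.continuous.smul hc).integrable_of_hasCompactSupport hs.smul_right
  have i3 : Integrable fun x => φ x • u x :=
    (hφ.continuous.smul hu).integrable_of_hasCompactSupport hs.smul_right
  have := integral_eq_zero_of_hasDerivAt_of_integrable
    (fun x => ((hφ.differentiable (by simp)).differentiableAt.hasDerivAt).smul (h x))
    (i2.add i1) i3
  rw [integral_add i2 i1] at this
  exact eq_neg_of_add_eq_zero_right this

/-- Assembling a homoclinic solution from a classical solution with exponential decay. -/
theorem isEvenHomoclinic_of_exp_decay {d ζ f κ C μ : ℝ} {a a' a'' : ℝ → ℂ} {b : ℂ} (hμ : 0 < μ)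
    (h1 : ∀ x, HasDerivAt a (a' x) x) (h2 : ∀ x, HasDerivAt a' (a'' x) x) (hc : Continuous a'')
    (heq : ∀ x, -(d : ℂ) * a'' x - (Complex.I - (ζ : ℂ)) * a x
      - (1 + Complex.I * (κ : ℂ)) * (‖a x‖ : ℂ) ^ 2 * a x + Complex.I * (f : ℂ) = 0)
    (heven : ∀ x, a (-x) = a x) (hne : ∃ x, a x ≠ b)
    (b0 : ∀ x, ‖a x - b‖ ≤ C * Real.exp (-μ * |x|))
    (b1 : ∀ x, ‖a' x‖ ≤ C * Real.exp (-μ * |x|))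
    (b2 : ∀ x, ‖a'' x‖ ≤ C * Real.exp (-μ * |x|)) :
    IsEvenHomoclinic d ζ f κ a b := by
  have e1 : deriv a = a' := funext fun x => (h1 x).deriv
  have e2 : deriv a' = a'' := funext fun x => (h2 x).deriv
  have ca : Continuous a := continuous_iff_continuousAt.2 fun x => (h1 x).continuousAt
  have ca' : Continuous a' := continuous_iff_continuousAt.2 fun x => (h2 x).continuousAt
  refine ⟨?_, fun x => ?_, ?_, heven, ?_, ⟨?_, a', a'', ?_, ?_, ?_, ?_⟩, hne⟩
  · rw [show (2 : WithTop ℕ∞) = 1 + 1 by norm_num, contDiff_succ_iff_deriv, e1,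
      contDiff_one_iff_deriv, e2]
    exact ⟨fun x => (h1 x).differentiableAt, by simp, fun x => (h2 x).differentiableAt, hc⟩
  · rw [e1, e2]; exact heq x
  · rw [e1]
    have h3 : HasDerivAt a (-a' 0) 0 := by
      have : HasDerivAt (fun x => a (-x)) (-a' 0) 0 :=
        ((h1 (-0)).scomp (0 : ℝ) (hasDerivAt_neg (0 : ℝ))).congr_deriv (by simp)
      simpa [heven] using this
    have := (h1 0).unique h3
    linear_combination (1 / 2 : ℂ) * this
  · rw [tendsto_iff_norm_sub_tendsto_zero]
    refine squeeze_zero (fun _ => norm_nonneg _) b0 ?_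
    have : Tendsto (fun x : ℝ => -μ * |x|) (cocompact ℝ) atBot :=
      (tendsto_norm_cocompact_atTop (E := ℝ)).const_mul_atTop_of_neg (by linarith)
    simpa using (Real.tendsto_exp_atBot.comp this).const_mul C
  · exact memLp_two_of_exp_decay hμ (ca.sub continuous_const) b0
  · exact isWeakDeriv_of_hasDerivAt (fun x => (h1 x).sub_const b) ca'
  · exact isWeakDeriv_of_hasDerivAt h2 hc
  · exact memLp_two_of_exp_decay hμ ca' b1
  · exact memLp_two_of_exp_decay hμ hc b2

/-- Exponential decay of an even continuous function near infinity extends to the whole line. -/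
theorem exists_exp_decay_of_even {E : ℝ → ℝ} {R K m : ℝ} (hE : Continuous E)
    (heven : ∀ x, E (-x) = E x) (h : ∀ x, R ≤ x → E x ≤ K * Real.exp (-m * (x - R))) :
    ∃ C, 0 ≤ C ∧ ∀ x, E x ≤ C * Real.exp (-m * |x|) := by
  obtain ⟨B, hB⟩ := (isCompact_Icc (a := 0) (b := R)).exists_bound_of_continuousOn
    (f := fun x => E x * Real.exp (m * x)) (by fun_prop)
  have key : ∀ x, 0 ≤ x → E x ≤ (|B| + |K| * Real.exp (m * R)) * Real.exp (-m * x) := by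
    intro x hx
    have hBK : 0 ≤ |B| * Real.exp (-m * x) := by positivity
    have hKK : 0 ≤ |K| * Real.exp (m * R) * Real.exp (-m * x) := by positivity
    rw [add_mul]
    rcases le_total x R with hR | hR
    · have h3 := (le_abs_self _).trans ((hB x ⟨hx, hR⟩).trans (le_abs_self B))
      have h4 := mul_le_mul_of_nonneg_right h3 (Real.exp_pos (-m * x)).le
      rw [mul_assoc, ← Real.exp_add] at h4
      simp only [neg_mul, add_neg_cancel, Real.exp_zero, mul_one] at h4 hKK ⊢
      linarith
    · have h3 := h x hR
      have h4 : K * Real.exp (-m * (x - R)) ≤ |K| * Real.exp (m * R) * Real.exp (-m * x) := by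
        rw [mul_assoc, ← Real.exp_add, show m * R + -m * x = -m * (x - R) by ring]
        exact mul_le_mul_of_nonneg_right (le_abs_self K) (Real.exp_pos _).le
      linarith
  refine ⟨|B| + |K| * Real.exp (m * R), by positivity, fun x => ?_⟩
  rcases abs_cases x with ⟨e, -⟩ | ⟨e, hx⟩
  · rw [e]; exact key x (e ▸ abs_nonneg x)
  · rw [e, ← heven]; exact key _ (by linarith)

/-- The first derivative of an even function inherits exponential decay from the function and its
second derivative. -/
theorem abs_deriv_le_exp_decay {φ φ' φ'' : ℝ → ℝ} {b C μ : ℝ} (hC : 0 ≤ C) (hμ : 0 < μ)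
    (h1 : ∀ x, HasDerivAt φ (φ' x) x) (h2 : ∀ x, HasDerivAt φ' (φ'' x) x)
    (heven : ∀ x, φ (-x) = φ x) (hφ : ∀ x, |φ x - b| ≤ C * Real.exp (-μ * |x|))
    (hφ'' : ∀ x, |φ'' x| ≤ C * Real.exp (-μ * |x|)) (x : ℝ) :
    |φ' x| ≤ 3 * C * Real.exp (-μ * |x|) := by
  have hexp : ∀ x y, 0 ≤ x → x ≤ y → C * Real.exp (-μ * |y|) ≤ C * Real.exp (-μ * |x|) := by
    intro x y hx hxy
    rw [abs_of_nonneg hx, abs_of_nonneg (hx.trans hxy)]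
    gcongr C * Real.exp ?_
    nlinarith
  have key : ∀ x, 0 ≤ x → |φ' x| ≤ 3 * C * Real.exp (-μ * |x|) := by
    intro x hx
    rw [mul_assoc]
    exact abs_deriv_le_of_abs_le (φ := fun x => φ x - b) (fun x => (h1 x).sub_const b) h2
      (fun y hy => (hφ y).trans (hexp x y hx hy)) fun y hy => (hφ'' y).trans (hexp x y hx hy)
  rcases le_total 0 x with hx | hx
  · exact key x hx
  · have hodd : φ' (-x) = -φ' x := by
      have h3 : HasDerivAt (fun y => φ (-y)) (φ' (-x) * -1) x := (h1 (-x)).comp x (hasDerivAt_neg x)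
      have h4 := h3.congr_of_eventuallyEq (f₁ := φ) (Eventually.of_forall fun y => (heven y).symm)
      linarith [(h1 x).unique h4]
    have := key (-x) (by linarith)
    rwa [hodd, abs_neg, abs_neg] at this

/-- The perturbed profile converges exponentially to an equilibrium near `w₀`. -/
theorem exists_decaying_profile {d ζ f w₀ s : ℝ} {w w' : ℝ → ℝ}
    (H : IsHomoclinicProfile d ζ f w₀ s w w') (hd : 0 < d) (hf : f ≠ 0)
    (hc : 0 < ζ - 3 * w₀ ^ 2) {r : ℝ} (hr : 0 < r) :
    ∃ δ > 0, ∀ ε κ : ℝ, |ε| < δ → |κ| < δ → ∃ (p p' q q' : ℝ → ℝ) (P Q C μ : ℝ),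
      0 < μ ∧ (∀ x, |p x - w x| < r) ∧ (∀ x, |q x| < r) ∧ |P - w₀| < r ∧
      (∀ x, p (-x) = p x) ∧ (∀ x, q (-x) = q x) ∧
      (∀ x, HasDerivAt p (p' x) x) ∧ (∀ x, HasDerivAt q (q' x) x) ∧
      (∀ x, HasDerivAt p' ((cubicField ζ f ((p x, q x), (ε, κ))).1 / d) x) ∧
      (∀ x, HasDerivAt q' ((cubicField ζ f ((p x, q x), (ε, κ))).2 / d) x) ∧
      (∀ x, |p x - P| ≤ C * Real.exp (-μ * |x|)) ∧ (∀ x, |q x - Q| ≤ C * Real.exp (-μ * |x|)) ∧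
      (∀ x, |p' x| ≤ C * Real.exp (-μ * |x|)) ∧ (∀ x, |q' x| ≤ C * Real.exp (-μ * |x|)) ∧
      (∀ x, |(cubicField ζ f ((p x, q x), (ε, κ))).1 / d| ≤ C * Real.exp (-μ * |x|)) ∧
      (∀ x, |(cubicField ζ f ((p x, q x), (ε, κ))).2 / d| ≤ C * Real.exp (-μ * |x|)) := by
  obtain ⟨ρ, hρ, hmono⟩ := exists_cubicField_monotone (f := f) hc
  have hr' : 0 < min r (ρ / 2) := lt_min hr (half_pos hρ)
  obtain ⟨δ₁, hδ₁, hsol⟩ := exists_perturbed_profile H hd hf hc hr'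
  obtain ⟨δ₂, hδ₂, heql⟩ := exists_equilibrium (f := f) hc H.equilibrium hr'
  refine ⟨min (min δ₁ δ₂) ρ, by positivity, fun ε κ hε hκ => ?_⟩
  obtain ⟨⟨hε1, hε2⟩, hε3⟩ := by simpa only [lt_min_iff] using hε
  obtain ⟨⟨hκ1, hκ2⟩, hκ3⟩ := by simpa only [lt_min_iff] using hκ
  obtain ⟨p, p', q, q', hpw, hqw, hpe, hqe, dp, dq, dp', dq'⟩ := hsol ε κ hε1 hκ1
  obtain ⟨P, Q, hP, hQ, hPQ⟩ := heql ε κ hε2 hκ2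
  rw [lt_min_iff] at hP hQ
  simp only [lt_min_iff] at hpw hqw
  have cp : Continuous p := continuous_iff_continuousAt.2 fun x => (dp x).continuousAt
  have cq : Continuous q := continuous_iff_continuousAt.2 fun x => (dq x).continuousAt
  obtain ⟨R, hR⟩ := Metric.tendsto_atTop.1 H.tendsto (ρ / 2) (half_pos hρ)
  have hnear : ∀ x, R ≤ x → |p x - w₀| < ρ := fun x hx => by
    have h1 := hR x hx
    rw [Real.dist_eq] at h1
    have h2 := abs_sub_le (p x) (w x) w₀
    linarith [(hpw x).2]
  have hqρ : ∀ x, |q x| < ρ := fun x => by linarith [(hqw x).2]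
  have hPρ : |P - w₀| < ρ := by linarith [hP.2]
  have hQρ : |Q| < ρ := by linarith [hQ.2]
  set m := Real.sqrt ((ζ - 3 * w₀ ^ 2) / d) with hm
  have hm0 : 0 < m := Real.sqrt_pos.2 (by positivity)
  have hm2 : m ^ 2 = (ζ - 3 * w₀ ^ 2) / d := Real.sq_sqrt (by positivity)
  -- the squared distance to the equilibrium is convex near infinity
  have hdecay : ∀ x, R ≤ x → (p x - P) ^ 2 + (q x - Q) ^ 2 ≤
      ((p R - P) ^ 2 + (q R - Q) ^ 2) * Real.exp (-m * (x - R)) := by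
    intro x hx
    refine le_exp_decay_of_sq_mul_le (p := fun x => (p x - P) ^ 2 + (q x - Q) ^ 2)
      (p' := fun x => 2 * (p x - P) * p' x + 2 * (q x - Q) * q' x)
      (p'' := fun x => 2 * p' x * p' x +
        2 * (p x - P) * ((cubicField ζ f ((p x, q x), (ε, κ))).1 / d) + (2 * q' x * q' x +
        2 * (q x - Q) * ((cubicField ζ f ((p x, q x), (ε, κ))).2 / d)))
      (M := 8 * ρ ^ 2) hm0 (fun y => ?_) (fun y => ?_) (fun y hy => ?_) (fun y hy => ?_) hx
    · exact ((((dp y).sub_const P).pow 2).add (((dq y).sub_const Q).pow 2)).congr_deriv (by simp)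
    · exact ((((dp y).sub_const P).const_mul 2).mul (dp' y)).add
        ((((dq y).sub_const Q).const_mul 2).mul (dq' y))
    · have h1 := hmono (p y) (q y) P Q ε κ (hnear y hy) (hqρ y) hPρ hQρ hε3 hκ3
      rw [hPQ, Prod.fst_zero, Prod.snd_zero, sub_zero, sub_zero] at h1
      have h2 : m ^ 2 * ((p y - P) ^ 2 + (q y - Q) ^ 2) = 2 / d *
          ((ζ - 3 * w₀ ^ 2) / 2 * ((p y - P) ^ 2 + (q y - Q) ^ 2)) := by rw [hm2]; ring
      rw [h2]
      refine (mul_le_mul_of_nonneg_left h1 (by positivity)).trans ?_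
      have : 0 ≤ 2 * (p' y * p' y) + 2 * (q' y * q' y) := by
        nlinarith [mul_self_nonneg (p' y), mul_self_nonneg (q' y)]
      refine le_of_sub_nonneg (this.trans_eq ?_)
      ring
    · have h1 : |p y - P| ≤ 2 * ρ := by
        have := abs_sub_le (p y) w₀ P
        rw [abs_sub_comm w₀] at this
        linarith [hnear y hy]
      have h2 : |q y - Q| ≤ 2 * ρ := by
        have := abs_sub (q y) Q
        linarith [hqρ y]
      have h3 := pow_le_pow_left₀ (abs_nonneg _) h1 2
      have h4 := pow_le_pow_left₀ (abs_nonneg _) h2 2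
      rw [sq_abs] at h3 h4
      linarith
  obtain ⟨C, hC, hCE⟩ := exists_exp_decay_of_even
    (E := fun x => (p x - P) ^ 2 + (q x - Q) ^ 2) (by fun_prop)
    (fun x => by rw [hpe, hqe]) hdecay
  have hsqrt : ∀ t x : ℝ, t ^ 2 ≤ C * Real.exp (-m * |x|) →
      |t| ≤ Real.sqrt C * Real.exp (-(m / 2) * |x|) := by
    intro t x h
    refine abs_le_of_sq_le_sq (h.trans_eq ?_) (by positivity)
    rw [mul_pow, Real.sq_sqrt hC, ← Real.exp_nat_mul]
    push_cast
    ring_nf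
  have bp : ∀ x, |p x - P| ≤ Real.sqrt C * Real.exp (-(m / 2) * |x|) := fun x =>
    hsqrt _ x (by linarith [hCE x, sq_nonneg (q x - Q)])
  have bq : ∀ x, |q x - Q| ≤ Real.sqrt C * Real.exp (-(m / 2) * |x|) := fun x =>
    hsqrt _ x (by linarith [hCE x, sq_nonneg (p x - P)])
  -- the second derivatives decay as the field is Lipschitz on bounded sets
  obtain ⟨L, hL0, hL⟩ : ∃ L, 0 ≤ L ∧
      ∀ x, ‖cubicField ζ f ((p x, q x), (ε, κ))‖ ≤ L * Real.exp (-(m / 2) * |x|) := by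
    have hsm : ContDiff ℝ 1 fun z : ℝ × ℝ => cubicField ζ f (z, (ε, κ)) := by
      unfold cubicField
      fun_prop
    set S := Metric.closedBall ((P, Q) : ℝ × ℝ) (Real.sqrt C) with hS
    obtain ⟨L, hL⟩ := hsm.locallyLipschitz.locallyLipschitzOn.exists_lipschitzOnWith_of_compact
      (isCompact_closedBall ((P, Q) : ℝ × ℝ) (Real.sqrt C))
    have hz : ∀ x, ‖(p x, q x) - (P, Q)‖ ≤ Real.sqrt C * Real.exp (-(m / 2) * |x|) := fun x =>
      max_le (bp x) (bq x)
    refine ⟨L * Real.sqrt C, by positivity, fun x => ?_⟩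
    have h1 : Real.exp (-(m / 2) * |x|) ≤ 1 :=
      Real.exp_le_one_iff.2 (by nlinarith [abs_nonneg x])
    have h2 := hL.norm_sub_le (x := (p x, q x)) (y := (P, Q))
      (mem_closedBall_iff_norm.2 ((hz x).trans (mul_le_of_le_one_right (Real.sqrt_nonneg C) h1)))
      (Metric.mem_closedBall_self (Real.sqrt_nonneg C))
    rw [hPQ, sub_zero] at h2
    rw [mul_assoc]
    exact h2.trans (mul_le_mul_of_nonneg_left (hz x) L.2)
  set K := max (Real.sqrt C) (L / d) with hK
  have hK0 : 0 ≤ K := (Real.sqrt_nonneg C).trans (le_max_left _ _)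
  have up1 : ∀ {t x : ℝ}, t ≤ Real.sqrt C * Real.exp (-(m / 2) * |x|) →
      t ≤ K * Real.exp (-(m / 2) * |x|) := fun h =>
    h.trans (mul_le_mul_of_nonneg_right (le_max_left _ _) (Real.exp_pos _).le)
  have up3 : ∀ {t x : ℝ}, t ≤ K * Real.exp (-(m / 2) * |x|) →
      t ≤ 3 * K * Real.exp (-(m / 2) * |x|) := fun h =>
    h.trans (mul_le_mul_of_nonneg_right (by linarith) (Real.exp_pos _).le)
  have up2 : ∀ {t x : ℝ}, |t| ≤ ‖cubicField ζ f ((p x, q x), (ε, κ))‖ →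
      |t / d| ≤ K * Real.exp (-(m / 2) * |x|) := by
    intro t x h
    rw [abs_div, abs_of_pos hd, div_le_iff₀ hd]
    have h1 : L ≤ K * d := (div_le_iff₀ hd).1 (le_max_right _ _)
    have h2 := mul_le_mul_of_nonneg_right h1 (Real.exp_pos (-(m / 2) * |x|)).le
    linarith [hL x]
  have bp2 : ∀ x, |(cubicField ζ f ((p x, q x), (ε, κ))).1 / d| ≤
      K * Real.exp (-(m / 2) * |x|) := fun x => up2 (norm_fst_le (cubicField ζ f ((p x, q x), (ε, κ))))
  have bq2 : ∀ x, |(cubicField ζ f ((p x, q x), (ε, κ))).2 / d| ≤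
      K * Real.exp (-(m / 2) * |x|) := fun x => up2 (norm_snd_le (cubicField ζ f ((p x, q x), (ε, κ))))
  exact ⟨p, p', q, q', P, Q, 3 * K, m / 2, half_pos hm0, fun x => (hpw x).1, fun x => (hqw x).1,
    hP.1, hpe, hqe, dp, dq, dp', dq', fun x => up3 (up1 (bp x)), fun x => up3 (up1 (bq x)),
    abs_deriv_le_exp_decay hK0 (half_pos hm0) dp dp' hpe (fun x => up1 (bp x)) bp2,
    abs_deriv_le_exp_decay hK0 (half_pos hm0) dq dq' hqe (fun x => up1 (bq x)) bq2,
    fun x => up3 (bp2 x), fun x => up3 (bq2 x)⟩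

/-! ### Rescaling -/

/-- One branch of solutions in the original variables, `a(x) = i k (p + i q)(k x)` with
`k = ε^{-1/2}`, close to the rescaled profile at `x = 0` and with a lower bound on its distance to
the limit at infinity. -/
theorem exists_branch {d ζ f w₀ s : ℝ} (hd : 0 < d) (hc : 0 < ζ - 3 * w₀ ^ 2)
    (h0 : ζ * w₀ - w₀ ^ 3 + f = 0) (hf : f ≠ 0) (hs : s = 1 ∨ s = -1) {r : ℝ} (hr : 0 < r) :
    ∃ δ > 0, ∃ η > 0, ∀ ε κ : ℝ, 0 < ε → ε < δ → 0 < κ → κ < δ → ∃ (a : ℝ → ℂ) (b : ℂ),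
      IsEvenHomoclinic d (ζ * ε⁻¹) (f * ε ^ (-(3 / 2) : ℝ)) κ a b ∧
      |(Real.sqrt ε * (a 0).im) - profile d ζ w₀ s 0| < r ∧
      η * (Real.sqrt ε)⁻¹ ≤ h2Norm (fun x => a x - b) ^ 2 := by
  obtain ⟨⟨w', H⟩, hsign⟩ := exists_isHomoclinicProfile hd hc h0 hs
  set w := profile d ζ w₀ s with hw
  have hwc : Continuous w := continuous_iff_continuousAt.2 fun x => (H.hasDerivAt x).continuousAt
  -- `g` is the least distance of the profile to `w₀` on `[-1, 1]`
  obtain ⟨g, hg, hgw⟩ : ∃ g > 0, ∀ x ∈ Set.Icc (-1 : ℝ) 1, g ≤ |w x - w₀| := by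
    obtain ⟨x₀, -, hx₀⟩ := (isCompact_Icc (a := (-1 : ℝ)) (b := 1)).exists_isMinOn
      (f := fun x => |w x - w₀|) ⟨0, by simp⟩ (by fun_prop)
    refine ⟨_, abs_pos.2 fun h => ?_, hx₀⟩
    simpa [h] using hsign x₀
  obtain ⟨δ, hδ, hsol⟩ := exists_decaying_profile H hd hf hc (r := min r (g / 4)) (by positivity)
  refine ⟨δ, hδ, g ^ 2 / 2, by positivity, fun ε κ hε hεδ hκ hκδ => ?_⟩
  obtain ⟨p, p', q, q', P, Q, C, μ, hμ, hpw, -, hP, hpe, hqe, dp, dq, dp', dq', bp, bq, bp', bq',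
    bp'', bq''⟩ := hsol ε κ (by rwa [abs_of_pos hε]) (by rwa [abs_of_pos hκ])
  simp only [lt_min_iff] at hpw hP
  set N := fun x => cubicField ζ f ((p x, q x), (ε, κ)) with hN
  have cp : Continuous p := continuous_iff_continuousAt.2 fun x => (dp x).continuousAt
  have cq : Continuous q := continuous_iff_continuousAt.2 fun x => (dq x).continuousAt
  have hPp : ∀ x ∈ Set.Icc (-1 : ℝ) 1, g / 2 ≤ |p x - P| := fun x hx => by
    have h1 := hgw x hx
    have h2 := abs_sub_le (w x) (p x) w₀
    have h3 := abs_sub_le (p x) P w₀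
    rw [abs_sub_comm (w x) (p x)] at h2
    linarith [(hpw x).2, hP.2]
  set k := (Real.sqrt ε)⁻¹ with hk
  have hse : 0 < Real.sqrt ε := Real.sqrt_pos.2 hε
  have hk0 : 0 < k := inv_pos.2 hse
  have hk2 : ε⁻¹ = k ^ 2 := by rw [hk, inv_pow, Real.sq_sqrt hε.le]
  have hk3 : ε ^ (-(3 / 2) : ℝ) = k ^ 3 := by
    rw [hk, inv_pow, Real.rpow_neg hε.le, Real.sqrt_eq_rpow, ← Real.rpow_natCast,
      ← Real.rpow_mul hε.le]
    norm_num
  -- the complex profile and its derivatives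
  set u : ℝ → ℂ := fun x => (p x : ℂ) + Complex.I * q x with hu
  set u' : ℝ → ℂ := fun x => (p' x : ℂ) + Complex.I * q' x with hu'
  set u'' : ℝ → ℂ := fun x => (((N x).1 / d : ℝ) : ℂ) + Complex.I * ((N x).2 / d : ℝ) with hu''
  set U : ℂ := (P : ℂ) + Complex.I * Q with hU
  have du : ∀ x, HasDerivAt u (u' x) x := fun x =>
    (dp x).ofReal_comp.add ((dq x).ofReal_comp.const_mul Complex.I)
  have du' : ∀ x, HasDerivAt u' (u'' x) x := fun x =>
    (dp' x).ofReal_comp.add ((dq' x).ofReal_comp.const_mul Complex.I)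
  have cu'' : Continuous u'' := by
    simp only [hu'', hN, cubicField]
    fun_prop
  have hlin : ∀ x, HasDerivAt (fun x : ℝ => k * x) k x := fun x => by
    simpa using (hasDerivAt_id x).const_mul k
  have hnorm : ∀ s t c : ℝ, |s| ≤ c → |t| ≤ c → ‖(s : ℂ) + Complex.I * t‖ ≤ 2 * c := by
    intro s t c h1 h2
    refine (norm_add_le _ _).trans ?_
    simp only [norm_mul, Complex.norm_I, one_mul, Complex.norm_real, Real.norm_eq_abs]
    linarith
  have hC : 0 ≤ C := by simpa using (abs_nonneg _).trans (bp 0)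
  set K := 2 * C * (k + k ^ 2 + k ^ 3) with hK
  have hbound : ∀ (z : ℂ) (x c : ℝ), 0 ≤ c → c ≤ k + k ^ 2 + k ^ 3 →
      ‖z‖ ≤ 2 * (C * Real.exp (-μ * |k * x|)) →
      ‖(c : ℂ) * (Complex.I * z)‖ ≤ K * Real.exp (-(μ * k) * |x|) := by
    intro z x c hc0 hck hz
    rw [abs_mul, abs_of_pos hk0, ← mul_assoc, neg_mul μ, ← neg_mul] at hz
    rw [norm_mul, norm_mul, Complex.norm_I, one_mul, Complex.norm_real, Real.norm_eq_abs,
      abs_of_nonneg hc0]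
    calc c * ‖z‖ ≤ (k + k ^ 2 + k ^ 3) * (2 * (C * Real.exp (-(μ * k) * |x|))) := by
          refine mul_le_mul hck (hz.trans_eq ?_) (norm_nonneg _) (by positivity)
          ring_nf
      _ = _ := by rw [hK]; ring
  set a : ℝ → ℂ := fun x => (k : ℂ) * (Complex.I * u (k * x)) with ha
  set b : ℂ := (k : ℂ) * (Complex.I * U) with hb
  have hab : ∀ x, a x - b = (k : ℂ) * (Complex.I * (u (k * x) - U)) := fun x => by
    simp only [ha, hb]; ring
  have huU : ∀ x, u x - U = ((p x - P : ℝ) : ℂ) + Complex.I * ((q x - Q : ℝ) : ℂ) := fun x => by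
    simp only [hu, hU]; push_cast; ring
  have hkk : k ^ 1 ≤ k + k ^ 2 + k ^ 3 ∧ k ^ 2 ≤ k + k ^ 2 + k ^ 3 ∧ k ^ 3 ≤ k + k ^ 2 + k ^ 3 := by
    have := pow_pos hk0 2
    have := pow_pos hk0 3
    refine ⟨?_, ?_, ?_⟩ <;> linarith
  have da : ∀ x, HasDerivAt a (((k ^ 2 : ℝ) : ℂ) * (Complex.I * u' (k * x))) x := fun x => by
    refine ((((du (k * x)).scomp x (hlin x)).const_mul Complex.I).const_mul (k : ℂ)).congr_deriv ?_
    rw [Complex.real_smul]; push_cast; ring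
  have da' : ∀ x, HasDerivAt (fun x => ((k ^ 2 : ℝ) : ℂ) * (Complex.I * u' (k * x)))
      (((k ^ 3 : ℝ) : ℂ) * (Complex.I * u'' (k * x))) x := fun x => by
    refine ((((du' (k * x)).scomp x (hlin x)).const_mul Complex.I).const_mul
      ((k ^ 2 : ℝ) : ℂ)).congr_deriv ?_
    rw [Complex.real_smul]; push_cast; ring
  have hlow : ∀ x, |p x - P| ≤ ‖u x - U‖ := fun x => by
    have := Complex.abs_re_le_norm (u x - U)
    rw [huU] at this ⊢
    simpa using this
  have hmain : IsEvenHomoclinic d (ζ * ε⁻¹) (f * ε ^ (-(3 / 2) : ℝ)) κ a b := by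
    refine isEvenHomoclinic_of_exp_decay (C := K) (mul_pos hμ hk0) da da' (by fun_prop)
      (fun x => ?_) (fun x => ?_) ⟨0, fun h => ?_⟩ (fun x => ?_) (fun x => ?_) fun x => ?_
    · have hsq : ((‖a x‖ : ℝ) : ℂ) ^ 2 = (k : ℂ) ^ 2 * ((p (k * x)) ^ 2 + (q (k * x)) ^ 2) := by
        have e : ‖a x‖ ^ 2 = k ^ 2 * (p (k * x) ^ 2 + q (k * x) ^ 2) := by
          rw [← Complex.normSq_eq_norm_sq]
          simp [ha, hu, Complex.normSq_apply]
          ring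
        exact_mod_cast congrArg (fun t : ℝ => (t : ℂ)) e
      have hεk : (ε : ℂ) * (k : ℂ) ^ 2 = 1 := by
        have : ε * k ^ 2 = 1 := by rw [← hk2, mul_inv_cancel₀ hε.ne']
        exact_mod_cast congrArg (fun t : ℝ => (t : ℂ)) this
      have hdu : (d : ℂ) * u'' (k * x) = ((N (k * x)).1 : ℂ) + Complex.I * ((N (k * x)).2 : ℂ) := by
        have : (d : ℂ) ≠ 0 := Complex.ofReal_ne_zero.2 hd.ne'
        simp only [hu'']; push_cast; field_simp
      rw [hsq, hk2, hk3]
      simp only [ha]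
      have e1 : -(d : ℂ) * (((k ^ 3 : ℝ) : ℂ) * (Complex.I * u'' (k * x)))
          = -((k : ℂ) ^ 3 * Complex.I) * (d * u'' (k * x)) := by push_cast; ring
      rw [e1, hdu]
      simp only [hN, hu, cubicField, smul_eq_mul, mul_one]
      push_cast
      generalize (p (k * x) : ℂ) = p₁
      generalize (q (k * x) : ℂ) = q₁
      linear_combination (norm := (ring_nf; simp only [Complex.I_sq, Complex.I_pow_three]; ring_nf))
        -(k : ℂ) * (p₁ + Complex.I * q₁) * hεk
    · simp only [ha, hu, mul_neg, hpe, hqe]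
    · have h1 := hab 0
      rw [h, sub_self, eq_comm, mul_zero] at h1
      have h2 := hPp 0 (by simp)
      have h3 := hlow 0
      have h4 : u 0 - U = 0 := by simpa [hk0.ne'] using h1
      rw [h4, norm_zero] at h3
      linarith
    · rw [hab]
      refine hbound _ x k hk0.le (by simpa using hkk.1) ?_
      rw [huU]
      exact hnorm _ _ _ (bp _) (bq _)
    · exact hbound _ x (k ^ 2) (by positivity) hkk.2.1 (hnorm _ _ _ (bp' _) (bq' _))
    · exact hbound _ x (k ^ 3) (by positivity) hkk.2.2 (hnorm _ _ _ (bp'' _) (bq'' _))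
  refine ⟨a, b, hmain, ?_, ?_⟩
  · have : (a 0).im = k * p 0 := by simp [ha, hu]
    rw [this, ← mul_assoc, hk, mul_inv_cancel₀ hse.ne', one_mul]
    exact (hpw 0).1
  · have cu : Continuous u := continuous_iff_continuousAt.2 fun x => (du x).continuousAt
    have hint : Integrable fun x => ‖u x - U‖ ^ 2 := by
      refine (memLp_two_iff_integrable_sq_norm (by fun_prop)).1
        (memLp_two_of_exp_decay (C := 2 * C) hμ (by fun_prop) fun x => ?_)
      rw [huU, mul_assoc]
      exact hnorm _ _ _ (bp _) (bq _)
    have h1 : g ^ 2 / 2 ≤ ∫ x, ‖u x - U‖ ^ 2 := by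
      have h2 := setIntegral_ge_of_const_le_real (μ := volume) (c := (g / 2) ^ 2)
        (measurableSet_Icc (a := (-1 : ℝ)) (b := 1)) (by simp) (fun x hx =>
          pow_le_pow_left₀ (by positivity) ((hPp x hx).trans (hlow x)) 2) hint.integrableOn
      have h3 := setIntegral_le_integral (s := Set.Icc (-1 : ℝ) 1) hint
        (Eventually.of_forall fun x => by positivity)
      refine le_trans (le_of_eq ?_) (h2.trans h3)
      rw [Real.volume_real_Icc]
      norm_num
      ring
    have h2 : ∫ x, ‖a x - b‖ ^ 2 = k * ∫ x, ‖u x - U‖ ^ 2 := by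
      have e : ∀ x, ‖a x - b‖ ^ 2 = k ^ 2 * ‖u (k * x) - U‖ ^ 2 := fun x => by
        rw [hab, norm_mul, norm_mul, Complex.norm_I, one_mul, Complex.norm_real,
          Real.norm_eq_abs, mul_pow, sq_abs]
      simp only [e]
      rw [integral_const_mul, Measure.integral_comp_mul_left (fun x => ‖u x - U‖ ^ 2) k,
        abs_of_pos (inv_pos.2 hk0), smul_eq_mul]
      field_simp
    have i1 : 0 ≤ ∫ x, ‖weakDeriv (fun x => a x - b) x‖ ^ 2 :=
      integral_nonneg fun x => by positivity
    have i2 : 0 ≤ ∫ x, ‖weakDeriv (weakDeriv (fun x => a x - b)) x‖ ^ 2 :=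
      integral_nonneg fun x => by positivity
    have i0 : 0 ≤ ∫ x, ‖a x - b‖ ^ 2 := integral_nonneg fun x => by positivity
    rw [h2Norm, Real.sq_sqrt (by positivity)]
    have := mul_le_mul_of_nonneg_left h1 hk0.le
    linarith

end LugiatoLefever
end

theorem theorem4 (d ζt ft : ℝ) (hd : 0 < d) (hζ : 0 < ζt) (hf0 : 0 < |ft|)
    (hf : |ft| < 2 * Real.sqrt 3 / 9 * ζt ^ (3 / 2 : ℝ)) :
    ∃ ε₀ : ℝ, 0 < ε₀ ∧ ∃ κ₀ : ℝ, 0 < κ₀ ∧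
      ∃ (a : Fin 2 → ℝ → ℝ → ℝ → ℂ) (aInf : Fin 2 → ℝ → ℝ → ℂ),
        (∀ ε κ : ℝ, 0 < ε → ε < ε₀ → 0 < κ → κ < κ₀ →
          (∀ j : Fin 2, LugiatoLefever.IsEvenHomoclinic d (ζt * ε⁻¹) (ft * ε ^ (-(3 / 2) : ℝ)) κ
            (a j ε κ) (aInf j ε κ)) ∧
          a 0 ε κ ≠ a 1 ε κ) ∧
        ∀ j : Fin 2, ∀ M : ℝ, ∃ δ : ℝ, 0 < δ ∧ ∀ ε κ : ℝ,
          0 < ε → ε < ε₀ → ε < δ → 0 < κ → κ < κ₀ →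
            M < LugiatoLefever.h2Norm (fun x => a j ε κ x - aInf j ε κ) := by
  open LugiatoLefever in
  have hft : ft ≠ 0 := abs_pos.1 hf0
  obtain ⟨w₀, hc, h0⟩ := exists_middle_root hζ hf
  set s : Fin 2 → ℝ := ![1, -1] with hs
  have hs' : ∀ j, s j = 1 ∨ s j = -1 := fun j => by fin_cases j <;> simp [hs]
  set y : Fin 2 → ℝ := fun j => profile d ζt w₀ (s j) 0 with hy
  have hy0 : w₀ < y 0 := by
    have := (exists_isHomoclinicProfile hd hc h0 (hs' 0)).2 0
    simp only [hs, Matrix.cons_val_zero, one_mul] at this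
    simp only [hy, hs, Matrix.cons_val_zero]
    linarith
  have hy1 : y 1 < w₀ := by
    have := (exists_isHomoclinicProfile hd hc h0 (hs' 1)).2 0
    simp only [hs, Matrix.cons_val_one, Matrix.cons_val_fin_one] at this
    simp only [hy, hs, Matrix.cons_val_one, Matrix.cons_val_fin_one]
    linarith
  have hr : 0 < (y 0 - y 1) / 2 := by linarith
  choose δ hδ η hη hsol using fun j => exists_branch hd hc h0 hft (hs' j) hr
  have hδ₀ : 0 < min (δ 0) (δ 1) := lt_min (hδ 0) (hδ 1)
  have hle : ∀ j, min (δ 0) (δ 1) ≤ δ j := fun j => by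
    fin_cases j
    · exact min_le_left _ _
    · exact min_le_right _ _
  have hex : ∀ j : Fin 2, ∀ ε κ : ℝ, ∃ (a : ℝ → ℂ) (b : ℂ),
      0 < ε → ε < min (δ 0) (δ 1) → 0 < κ → κ < min (δ 0) (δ 1) →
      IsEvenHomoclinic d (ζt * ε⁻¹) (ft * ε ^ (-(3 / 2) : ℝ)) κ a b ∧
      |(Real.sqrt ε * (a 0).im) - y j| < (y 0 - y 1) / 2 ∧
      η j * (Real.sqrt ε)⁻¹ ≤ h2Norm (fun x => a x - b) ^ 2 := by
    intro j ε κ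
    by_cases h : 0 < ε ∧ ε < min (δ 0) (δ 1) ∧ 0 < κ ∧ κ < min (δ 0) (δ 1)
    · obtain ⟨a, b, hab⟩ := hsol j ε κ h.1 (h.2.1.trans_le (hle j)) h.2.2.1
        (h.2.2.2.trans_le (hle j))
      exact ⟨a, b, fun _ _ _ _ => hab⟩
    · exact ⟨0, 0, fun h1 h2 h3 h4 => absurd ⟨h1, h2, h3, h4⟩ h⟩
  choose a b hab using hex
  refine ⟨_, hδ₀, _, hδ₀, a, b, fun ε κ h1 h2 h3 h4 => ⟨fun j => (hab j ε κ h1 h2 h3 h4).1,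
    fun he => ?_⟩, fun j M => ?_⟩
  · have k0 := abs_lt.1 (hab 0 ε κ h1 h2 h3 h4).2.1
    have k1 := abs_lt.1 (hab 1 ε κ h1 h2 h3 h4).2.1
    rw [he] at k0
    linarith [k0.1, k1.2]
  · refine ⟨(η j / (M ^ 2 + 1)) ^ 2, pow_pos (div_pos (hη j) (by positivity)) 2,
      fun ε κ h1 h2 h3 h4 h5 => ?_⟩
    have hlow := (hab j ε κ h1 h2 h4 h5).2.2
    have hse : 0 < Real.sqrt ε := Real.sqrt_pos.2 h1
    have hlt : Real.sqrt ε < η j / (M ^ 2 + 1) :=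
      (Real.sqrt_lt' (div_pos (hη j) (by positivity))).2 h3
    have hM : M ^ 2 + 1 < η j * (Real.sqrt ε)⁻¹ := by
      rw [← div_eq_mul_inv, lt_div_iff₀ hse, mul_comm]
      exact (lt_div_iff₀ (by positivity)).1 hlt
    exact lt_of_pow_lt_pow_left₀ 2 (Real.sqrt_nonneg _) (by linarith)
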